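/- Let $M$ be a closed (compact, without boundary) smooth 4-manifold and let $\varphi\colon M\to\mathbb S^5\subset\mathbb R^6$ be a smooth immersion into the unit sphere, with $M$ carrying the induced Riemannian metric. For a point $q\in M$ and a unit normal $\nu$ of the hypersurface at $q$ (tangent to $\mathbb S^5$, unique up to sign), let $A_\nu$ be the second fundamental form in $\mathbb S^5$ with respect to $\nu$, and let the principal curvatures be the eigenvalues of the corresponding shape operator, counted with multiplicity. Suppose that - $M$ is minimal, i.e. the mean curvature (one quarter of the sum of the four principal curvatures) vanishes at every point; - the scalar curvature of the induced metric is constant on $M$; - the Gauss–Kronecker curvature (the product of the four principal curvatures) vanishes at every point. If at some point $p\in M$, for some choice of the unit normal at $p$, the smallest or the largest principal curvature has multiplicity exactly two, then $M$ is totally geodesic, i.e. its second fundamental form vanishes identically. -/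

import Mathlib

open scoped Manifold ContDiff InnerProductSpace

noncomputable section

namespace SphereHypersurface

/-! ### Local geometry of a parametrized hypersurface

`F : ℝⁿ → V` is a local parametrization and `x` a point of its coordinate domain. -/

section LocalGeometry

variable {n : ℕ} {V : Type*} [NormedAddCommGroup V] [InnerProductSpace ℝ V]

/-- The partial derivative `∂ᵢ u` at `x` of a (scalar or vector valued) function on `ℝⁿ`. -/
def pderiv {W : Type*} [NormedAddCommGroup W] [NormedSpace ℝ W]
    (u : EuclideanSpace ℝ (Fin n) → W) (i : Fin n) (x : EuclideanSpace ℝ (Fin n)) : W :=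
  fderiv ℝ u x (EuclideanSpace.single i (1 : ℝ))

/-- The induced metric (first fundamental form) `gᵢⱼ = ⟨∂ᵢF, ∂ⱼF⟩`. -/
def metric (F : EuclideanSpace ℝ (Fin n) → V) (x : EuclideanSpace ℝ (Fin n)) :
    Matrix (Fin n) (Fin n) ℝ :=
  Matrix.of fun i j => ⟪pderiv F i x, pderiv F j x⟫_ℝ

/-- The Christoffel symbols of the induced metric,
`Γᵏᵢⱼ = ½ ∑ₗ gᵏˡ (∂ᵢ gⱼₗ + ∂ⱼ gᵢₗ - ∂ₗ gᵢⱼ)`. -/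
def christoffel (F : EuclideanSpace ℝ (Fin n) → V) (k i j : Fin n)
    (x : EuclideanSpace ℝ (Fin n)) : ℝ :=
  (1 / 2 : ℝ) * ∑ l, (metric F x)⁻¹ k l *
    (pderiv (fun y => metric F y j l) i x + pderiv (fun y => metric F y i l) j x
      - pderiv (fun y => metric F y i j) l x)

/-- The curvature tensor of the induced metric: `riemann F l k i j` is the coefficient of `∂ₗ`
in `R(∂ᵢ, ∂ⱼ)∂ₖ = ∇ᵢ∇ⱼ∂ₖ - ∇ⱼ∇ᵢ∂ₖ`. -/
def riemann (F : EuclideanSpace ℝ (Fin n) → V) (l k i j : Fin n)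
    (x : EuclideanSpace ℝ (Fin n)) : ℝ :=
  pderiv (christoffel F l j k) i x - pderiv (christoffel F l i k) j x
    + ∑ m, (christoffel F l i m x * christoffel F m j k x
      - christoffel F l j m x * christoffel F m i k x)

/-- The Ricci tensor `Ricⱼₖ`, the trace of `X ↦ R(X, ∂ⱼ)∂ₖ`. -/
def ricci (F : EuclideanSpace ℝ (Fin n) → V) (j k : Fin n)
    (x : EuclideanSpace ℝ (Fin n)) : ℝ :=
  ∑ i, riemann F i k i j x

/-- The (intrinsic) scalar curvature of the induced metric. -/
def scalarCurvature (F : EuclideanSpace ℝ (Fin n) → V) (x : EuclideanSpace ℝ (Fin n)) : ℝ :=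
  ∑ j, ∑ k, (metric F x)⁻¹ j k * ricci F j k x

/-- `ν` is a unit normal at `x` of the hypersurface, regarded as a hypersurface of the unit sphere
of `V`: it is tangent to the sphere at `F x` and orthogonal to the hypersurface. -/
def IsUnitNormal (F : EuclideanSpace ℝ (Fin n) → V) (x : EuclideanSpace ℝ (Fin n))
    (ν : V) : Prop :=
  ‖ν‖ = 1 ∧ ⟪F x, ν⟫_ℝ = 0 ∧ ∀ i, ⟪pderiv F i x, ν⟫_ℝ = 0

/-- The second fundamental form in the sphere with respect to the unit normal `ν`:
`hᵢⱼ = ⟨∂ᵢ∂ⱼF, ν⟩`. The covariant derivative of the sphere is the tangential part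
of the derivative of `V`, and `ν` is tangent to the sphere. -/
def secondFundamentalForm (F : EuclideanSpace ℝ (Fin n) → V) (x : EuclideanSpace ℝ (Fin n))
    (ν : V) : Matrix (Fin n) (Fin n) ℝ :=
  Matrix.of fun i j => ⟪pderiv (pderiv F j) i x, ν⟫_ℝ

/-- The matrix `g⁻¹ h` of the shape operator in the coordinate frame. -/
def shapeMatrix (F : EuclideanSpace ℝ (Fin n) → V) (x : EuclideanSpace ℝ (Fin n))
    (ν : V) : Matrix (Fin n) (Fin n) ℝ :=
  (metric F x)⁻¹ * secondFundamentalForm F x ν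

/-- The shape operator, an endomorphism of the tangent space in the coordinate frame. -/
def shapeOperator (F : EuclideanSpace ℝ (Fin n) → V) (x : EuclideanSpace ℝ (Fin n))
    (ν : V) : Module.End ℝ (Fin n → ℝ) :=
  Matrix.toLin' (shapeMatrix F x ν)

/-- The mean curvature `H = (1/n) tr A`. -/
def meanCurvature (F : EuclideanSpace ℝ (Fin n) → V) (x : EuclideanSpace ℝ (Fin n))
    (ν : V) : ℝ :=
  (1 / (n : ℝ)) * (shapeMatrix F x ν).trace

/-- The Gauss–Kronecker curvature, the product of all the principal curvatures. -/
def gaussKronecker (F : EuclideanSpace ℝ (Fin n) → V) (x : EuclideanSpace ℝ (Fin n))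
    (ν : V) : ℝ :=
  (shapeMatrix F x ν).det

/-- The set of principal curvatures with respect to the unit normal `ν`. -/
def principalCurvatures (F : EuclideanSpace ℝ (Fin n) → V) (x : EuclideanSpace ℝ (Fin n))
    (ν : V) : Set ℝ :=
  {μ | (shapeOperator F x ν).HasEigenvalue μ}

/-- The multiplicity of `μ` as a principal curvature (the shape operator is self-adjoint for
the metric, so geometric and algebraic multiplicities agree). -/
def principalMultiplicity (F : EuclideanSpace ℝ (Fin n) → V) (x : EuclideanSpace ℝ (Fin n))
    (ν : V) (μ : ℝ) : ℕ :=
  Module.finrank ℝ ((shapeOperator F x ν).eigenspace μ)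

end LocalGeometry

/-! ### Immersed hypersurfaces of `S⁵` -/

/-- The unit sphere `S⁵` in `ℝ⁶`. -/
abbrev S5 : Type := Metric.sphere (0 : EuclideanSpace ℝ (Fin 6)) 1

section Global

variable {M : Type*} [TopologicalSpace M] [ChartedSpace (EuclideanSpace ℝ (Fin 4)) M]

/-- `φ` is a smooth immersion of the 4-manifold `M` into `S⁵`. -/
def IsSmoothImmersion (φ : M → S5) : Prop :=
  ContMDiff (𝓡 4) (𝓡 5) ∞ φ ∧
    ∀ p, Function.Injective (mfderiv (𝓡 4) (𝓡 5) φ p)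

/-- The local parametrization of the hypersurface, as a map into `ℝ⁶`, given by a chart. -/
def localParam (φ : M → S5) (e : OpenPartialHomeomorph M (EuclideanSpace ℝ (Fin 4))) :
    EuclideanSpace ℝ (Fin 4) → EuclideanSpace ℝ (Fin 6) :=
  fun x => (φ (e.symm x) : EuclideanSpace ℝ (Fin 6))

/-- The mean curvature vanishes identically. (No orientation is assumed: both unit normals at each
point are allowed.) -/
def IsMinimal (φ : M → S5) : Prop :=
  ∀ e ∈ atlas (EuclideanSpace ℝ (Fin 4)) M, ∀ x ∈ e.target, ∀ ν,
    IsUnitNormal (localParam φ e) x ν → meanCurvature (localParam φ e) x ν = 0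

/-- The scalar curvature of the induced metric is one constant on all of `M`. -/
def HasConstantScalarCurvature (φ : M → S5) : Prop :=
  ∃ c : ℝ, ∀ e ∈ atlas (EuclideanSpace ℝ (Fin 4)) M, ∀ x ∈ e.target,
    scalarCurvature (localParam φ e) x = c

/-- The Gauss–Kronecker curvature vanishes identically. -/
def HasZeroGaussKronecker (φ : M → S5) : Prop :=
  ∀ e ∈ atlas (EuclideanSpace ℝ (Fin 4)) M, ∀ x ∈ e.target, ∀ ν,
    IsUnitNormal (localParam φ e) x ν → gaussKronecker (localParam φ e) x ν = 0

/-- The second fundamental form vanishes identically. -/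
def IsTotallyGeodesic (φ : M → S5) : Prop :=
  ∀ e ∈ atlas (EuclideanSpace ℝ (Fin 4)) M, ∀ x ∈ e.target, ∀ ν,
    IsUnitNormal (localParam φ e) x ν → secondFundamentalForm (localParam φ e) x ν = 0

/-- At `p`, for some choice of the unit normal, the smallest principal curvature has
multiplicity `k`. -/
def SmallestHasMultiplicity (φ : M → S5) (p : M) (k : ℕ) : Prop :=
  ∃ e ∈ atlas (EuclideanSpace ℝ (Fin 4)) M, p ∈ e.source ∧
    ∃ ν, IsUnitNormal (localParam φ e) (e p) ν ∧
      ∃ μ, IsLeast (principalCurvatures (localParam φ e) (e p) ν) μ ∧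
        principalMultiplicity (localParam φ e) (e p) ν μ = k

/-- At `p`, for some choice of the unit normal, the largest principal curvature has
multiplicity `k`. -/
def LargestHasMultiplicity (φ : M → S5) (p : M) (k : ℕ) : Prop :=
  ∃ e ∈ atlas (EuclideanSpace ℝ (Fin 4)) M, p ∈ e.source ∧
    ∃ ν, IsUnitNormal (localParam φ e) (e p) ν ∧
      ∃ μ, IsGreatest (principalCurvatures (localParam φ e) (e p) ν) μ ∧
        principalMultiplicity (localParam φ e) (e p) ν μ = k

end Global

end SphereHypersurface

end

/-! The argument is local near $p$; the constancy of the scalar curvature then carries its outcome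
to all of $M$. Let $A$ be the shape operator. By the Gauss equation and minimality the scalar
curvature is $12-\operatorname{tr}A^2$, so $\operatorname{tr}A^2$ is a constant, and it is enough to
show that this constant is zero.

At $p$ the vanishing trace and determinant, together with an extreme eigenvalue of multiplicity
exactly two, force the spectrum $-2a,0,a,a$ (`eq_of_least_double`). Suppose $a\neq0$. Then $\ker A$
is a line at $p$, and since $\det A=0$ it is spanned near $p$ by a smooth unit field $X$
(`exists_nullityField`), whose integral curves are great circles (`fderiv_ambientField_field`). Put
$C=\nabla X$. The Codazzi equation makes $AC$ self-adjoint. Up to commutators with the coordinate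
derivative $DX$, differentiation along $X$ is given by $A'=-CA$ and $C'=-C^2-1+R$ with $AR=0$.

Commutators with $DX$ contribute nothing to the derivative of the trace of a word in $A$ and $C$.
Differentiating $\operatorname{tr}A=0$ and $\operatorname{tr}A^2=\text{const}$ twice along $X$
therefore gives $\operatorname{tr}CA=0$, $\operatorname{tr}CA^2=0$, $\operatorname{tr}C^2A=0$ and
$2\operatorname{tr}C^2A^2+\operatorname{tr}CACA+\operatorname{tr}A^2=0$. For the spectrum
$-2a,0,a,a$ the third identity becomes $2a$ times a sum of squares of entries of $C$. Those entries
vanish, and the fourth identity reduces to $6a^2=0$ (`eq_zero_of_splitting_identities`). Hence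
$a=0$, $\operatorname{tr}A^2=0$ everywhere, and $A=0$ because $A$ is self-adjoint. -/

noncomputable section

namespace SphereHypersurface

/-! ### Tangential projection as a smooth function of the differential. -/

section TangentCoordinates

variable {n : ℕ} {V : Type*} [NormedAddCommGroup V] [InnerProductSpace ℝ V] [CompleteSpace V]

/-- The tangential coordinates of an ambient vector: the left inverse `(L* L)⁻¹ L*` of an
injective linear map `L`, whose kernel is the orthogonal complement of the range of `L`. -/
def tangentCoord (L : EuclideanSpace ℝ (Fin n) →L[ℝ] V) : V →L[ℝ] EuclideanSpace ℝ (Fin n) :=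
  Ring.inverse (L.adjoint ∘L L) ∘L L.adjoint

lemma isUnit_of_injective {L : EuclideanSpace ℝ (Fin n) →L[ℝ] EuclideanSpace ℝ (Fin n)}
    (hL : Function.Injective L) : IsUnit L := by
  have hs : Function.Surjective L := LinearMap.surjective_of_injective (f := L.toLinearMap) hL
  exact ContinuousLinearMap.isUnit_iff_bijective.2 ⟨hL, hs⟩

lemma isUnit_adjoint_comp_self {L : EuclideanSpace ℝ (Fin n) →L[ℝ] V}
    (hL : Function.Injective L) : IsUnit (L.adjoint ∘L L) := by
  apply isUnit_of_injective
  rw [injective_iff_map_eq_zero]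
  intro v hv
  have h : ⟪L v, L v⟫_ℝ = 0 := by
    rw [← ContinuousLinearMap.adjoint_inner_right]
    simpa using congrArg (fun w => ⟪v, w⟫_ℝ) hv
  exact (injective_iff_map_eq_zero L).1 hL v (inner_self_eq_zero.1 h)

lemma tangentCoord_apply_self {L : EuclideanSpace ℝ (Fin n) →L[ℝ] V}
    (hL : Function.Injective L) (v : EuclideanSpace ℝ (Fin n)) : tangentCoord L (L v) = v := by
  have h := Ring.inverse_mul_cancel _ (isUnit_adjoint_comp_self hL)
  exact DFunLike.congr_fun h v

lemma inner_apply_tangentCoord {L : EuclideanSpace ℝ (Fin n) →L[ℝ] V}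
    (hL : Function.Injective L) (v : EuclideanSpace ℝ (Fin n)) (w : V) :
    ⟪L v, L (tangentCoord L w)⟫_ℝ = ⟪L v, w⟫_ℝ := by
  have h := Ring.mul_inverse_cancel _ (isUnit_adjoint_comp_self hL)
  have h' : L.adjoint (L (tangentCoord L w)) = L.adjoint w :=
    DFunLike.congr_fun h (L.adjoint w)
  rw [← ContinuousLinearMap.adjoint_inner_right, h', ContinuousLinearMap.adjoint_inner_right]

lemma tangentCoord_eq_zero {L : EuclideanSpace ℝ (Fin n) →L[ℝ] V} {w : V}
    (hw : ∀ v, ⟪L v, w⟫_ℝ = 0) : tangentCoord L w = 0 := by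
  have h : L.adjoint w = 0 := by
    apply ext_inner_left ℝ
    intro v
    rw [ContinuousLinearMap.adjoint_inner_right, hw, inner_zero_right]
  simp [tangentCoord, h]

lemma isBoundedLinearMap_adjoint :
    IsBoundedLinearMap ℝ (fun L : EuclideanSpace ℝ (Fin n) →L[ℝ] V => L.adjoint) :=
  { map_add := fun a b => map_add _ a b
    map_smul := fun c a => by simp
    bound := ⟨1, one_pos, fun a => by simp⟩ }

lemma contDiffAt_tangentCoord {L : EuclideanSpace ℝ (Fin n) →L[ℝ] V}
    (hL : Function.Injective L) :
    ContDiffAt ℝ ∞ (tangentCoord (n := n) (V := V)) L := by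
  have hadj : ContDiffAt ℝ ∞ (fun L : EuclideanSpace ℝ (Fin n) →L[ℝ] V => L.adjoint) L :=
    isBoundedLinearMap_adjoint.contDiff.contDiffAt
  have hcomp : ContDiffAt ℝ ∞
      (fun L : EuclideanSpace ℝ (Fin n) →L[ℝ] V => L.adjoint ∘L L) L :=
    hadj.clm_comp contDiffAt_id
  obtain ⟨u, hu⟩ := isUnit_adjoint_comp_self hL
  have hinv : ContDiffAt ℝ ∞
      (fun L : EuclideanSpace ℝ (Fin n) →L[ℝ] V => Ring.inverse (L.adjoint ∘L L)) L := by
    refine ContDiffAt.comp (g := Ring.inverse) L ?_ hcomp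
    rw [← hu]
    exact contDiffAt_ringInverse ℝ u
  exact hinv.clm_comp hadj

/-- Two orthonormal vectors normal to the `n`-dimensional range of `L` complete it to an ambient
space of dimension `n + 2`. -/
lemma tangentCoord_decomposition [FiniteDimensional ℝ V]
    (hV : Module.finrank ℝ V = n + 2) {L : EuclideanSpace ℝ (Fin n) →L[ℝ] V}
    (hL : Function.Injective L) {p q : V} (hp : ⟪p, p⟫_ℝ = 1) (hq : ⟪q, q⟫_ℝ = 1)
    (hpq : ⟪p, q⟫_ℝ = 0) (hLp : ∀ v, ⟪L v, p⟫_ℝ = 0) (hLq : ∀ v, ⟪L v, q⟫_ℝ = 0) (w : V) :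
    w = L (tangentCoord L w) + ⟪w, p⟫_ℝ • p + ⟪w, q⟫_ℝ • q := by
  let J : (EuclideanSpace ℝ (Fin n) × ℝ × ℝ) →ₗ[ℝ] V :=
    L.toLinearMap.coprod ((LinearMap.toSpanSingleton ℝ V p).coprod
      (LinearMap.toSpanSingleton ℝ V q))
  have hJ : ∀ u s t, J (u, s, t) = L u + (s • p + t • q) := fun u s t => by simp [J]
  have hinj : Function.Injective J := by
    rw [injective_iff_map_eq_zero]
    rintro ⟨u, s, t⟩ h
    rw [hJ] at h
    have h1 := congrArg (fun z => ⟪z, p⟫_ℝ) h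
    have h2 := congrArg (fun z => ⟪z, q⟫_ℝ) h
    have hqp : ⟪q, p⟫_ℝ = 0 := by rw [real_inner_comm, hpq]
    simp only [inner_add_left, inner_smul_left, hLp, hLq, hp, hq, hpq, hqp, inner_zero_left]
      at h1 h2
    have hs : s = 0 := by simpa using h1
    have ht : t = 0 := by simpa using h2
    subst hs ht
    have hu : u = 0 := (injective_iff_map_eq_zero L).1 hL u (by simpa using h)
    simp [hu]
  have hsurj : Function.Surjective J := by
    refine (LinearMap.injective_iff_surjective_of_finrank_eq_finrank ?_).1 hinj
    rw [hV]; simp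
  set r := w - (L (tangentCoord L w) + ⟪w, p⟫_ℝ • p + ⟪w, q⟫_ℝ • q) with hr
  have hrz : r = 0 := by
    obtain ⟨⟨u, s, t⟩, hu⟩ := hsurj r
    rw [hJ] at hu
    have hqp : ⟪q, p⟫_ℝ = 0 := by rw [real_inner_comm, hpq]
    have e1 : ⟪L u, r⟫_ℝ = 0 := by
      rw [hr, inner_sub_right, inner_add_right, inner_add_right, inner_smul_right,
        inner_smul_right, inner_apply_tangentCoord hL, hLp, hLq]; ring
    have e2 : ⟪p, r⟫_ℝ = 0 := by
      rw [hr, inner_sub_right, inner_add_right, inner_add_right, inner_smul_right,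
        inner_smul_right, real_inner_comm _ p, real_inner_comm (L _) p, hLp, hp, hpq]; ring
    have e3 : ⟪q, r⟫_ℝ = 0 := by
      rw [hr, inner_sub_right, inner_add_right, inner_add_right, inner_smul_right,
        inner_smul_right, real_inner_comm _ q, real_inner_comm (L _) q, hLq, hq, hqp]; ring
    rw [← inner_self_eq_zero (𝕜 := ℝ)]
    nth_rewrite 1 [← hu]
    rw [inner_add_left, inner_add_left, inner_smul_left, inner_smul_left, e1, e2, e3]
    simp
  rw [hr, sub_eq_zero] at hrz
  exact hrz

end TangentCoordinates

/-! ### Hypersurface patches of the sphere and the Weingarten map. -/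

section Patch

variable {n : ℕ} {V : Type*} [NormedAddCommGroup V] [InnerProductSpace ℝ V]

/-- `F` is, on the open set `U`, a smooth immersion into the unit sphere of `V`, and `N` is
a smooth field of unit normals to it that are tangent to the sphere. -/
structure IsHypersurfacePatch (F N : EuclideanSpace ℝ (Fin n) → V)
    (U : Set (EuclideanSpace ℝ (Fin n))) : Prop where
  isOpen : IsOpen U
  contDiffAt_param : ∀ x ∈ U, ContDiffAt ℝ ∞ F x
  contDiffAt_normal : ∀ x ∈ U, ContDiffAt ℝ ∞ N x
  injective_fderiv : ∀ x ∈ U, Function.Injective (fderiv ℝ F x)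
  inner_param_self : ∀ x ∈ U, ⟪F x, F x⟫_ℝ = 1
  inner_normal_self : ∀ x ∈ U, ⟪N x, N x⟫_ℝ = 1
  inner_param_normal : ∀ x ∈ U, ⟪F x, N x⟫_ℝ = 0
  inner_fderiv_normal : ∀ x ∈ U, ∀ v, ⟪fderiv ℝ F x v, N x⟫_ℝ = 0

/-- The Weingarten map in the coordinate frame, `dN = -dF ∘ A`. -/
def weingarten [CompleteSpace V] (F N : EuclideanSpace ℝ (Fin n) → V)
    (x : EuclideanSpace ℝ (Fin n)) :
    EuclideanSpace ℝ (Fin n) →L[ℝ] EuclideanSpace ℝ (Fin n) :=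
  -(tangentCoord (fderiv ℝ F x) ∘L fderiv ℝ N x)

lemma minSmoothness_two_le_infty : minSmoothness ℝ 2 ≤ (∞ : WithTop ℕ∞) := by
  simp only [minSmoothness_of_isRCLikeNormedField]
  exact WithTop.coe_le_coe.2 (le_top : (2 : ℕ∞) ≤ ⊤)

/-- The derivative of an inner product that is constant on an open set vanishes. -/
lemma inner_fderiv_add_eq_zero {E : Type*} [NormedAddCommGroup E] [NormedSpace ℝ E]
    {f g : E → V} {U : Set E} (hU : IsOpen U) {c : ℝ}
    (hfg : ∀ y ∈ U, ⟪f y, g y⟫_ℝ = c) {x : E} (hx : x ∈ U) (hf : DifferentiableAt ℝ f x)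
    (hg : DifferentiableAt ℝ g x) (v : E) :
    ⟪f x, fderiv ℝ g x v⟫_ℝ + ⟪fderiv ℝ f x v, g x⟫_ℝ = 0 := by
  rw [← fderiv_inner_apply ℝ hf hg]
  have h : (fun y => ⟪f y, g y⟫_ℝ) =ᶠ[nhds x] fun _ => c := by
    filter_upwards [hU.mem_nhds hx] with y hy using hfg y hy
  rw [h.fderiv_eq]
  simp

namespace IsHypersurfacePatch

variable {F N : EuclideanSpace ℝ (Fin n) → V} {U : Set (EuclideanSpace ℝ (Fin n))}
  {x : EuclideanSpace ℝ (Fin n)}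

lemma differentiableAt_param (h : IsHypersurfacePatch F N U) (hx : x ∈ U) :
    DifferentiableAt ℝ F x := (h.contDiffAt_param x hx).differentiableAt (by simp)

lemma differentiableAt_normal (h : IsHypersurfacePatch F N U) (hx : x ∈ U) :
    DifferentiableAt ℝ N x := (h.contDiffAt_normal x hx).differentiableAt (by simp)

lemma contDiffAt_fderiv_param (h : IsHypersurfacePatch F N U) (hx : x ∈ U) :
    ContDiffAt ℝ ∞ (fderiv ℝ F) x := (h.contDiffAt_param x hx).fderiv_right (by simp)

lemma contDiffAt_fderiv_normal (h : IsHypersurfacePatch F N U) (hx : x ∈ U) :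
    ContDiffAt ℝ ∞ (fderiv ℝ N) x := (h.contDiffAt_normal x hx).fderiv_right (by simp)

lemma differentiableAt_fderiv_param (h : IsHypersurfacePatch F N U) (hx : x ∈ U) :
    DifferentiableAt ℝ (fderiv ℝ F) x := (h.contDiffAt_fderiv_param hx).differentiableAt (by simp)

lemma differentiableAt_fderiv_normal (h : IsHypersurfacePatch F N U) (hx : x ∈ U) :
    DifferentiableAt ℝ (fderiv ℝ N) x :=
  (h.contDiffAt_fderiv_normal hx).differentiableAt (by simp)

lemma fderiv_fderiv_param_comm (h : IsHypersurfacePatch F N U) (hx : x ∈ U)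
    (u v : EuclideanSpace ℝ (Fin n)) :
    fderiv ℝ (fderiv ℝ F) x u v = fderiv ℝ (fderiv ℝ F) x v u :=
  ((h.contDiffAt_param x hx).isSymmSndFDerivAt
    minSmoothness_two_le_infty) u v

lemma fderiv_fderiv_normal_comm (h : IsHypersurfacePatch F N U) (hx : x ∈ U)
    (u v : EuclideanSpace ℝ (Fin n)) :
    fderiv ℝ (fderiv ℝ N) x u v = fderiv ℝ (fderiv ℝ N) x v u :=
  ((h.contDiffAt_normal x hx).isSymmSndFDerivAt
    minSmoothness_two_le_infty) u v

lemma inner_param_fderiv (h : IsHypersurfacePatch F N U) (hx : x ∈ U)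
    (v : EuclideanSpace ℝ (Fin n)) : ⟪F x, fderiv ℝ F x v⟫_ℝ = 0 := by
  have := inner_fderiv_add_eq_zero h.isOpen h.inner_param_self hx (h.differentiableAt_param hx)
    (h.differentiableAt_param hx) v
  rw [real_inner_comm (F x)] at this
  linarith

lemma inner_normal_fderiv (h : IsHypersurfacePatch F N U) (hx : x ∈ U)
    (v : EuclideanSpace ℝ (Fin n)) : ⟪N x, fderiv ℝ N x v⟫_ℝ = 0 := by
  have := inner_fderiv_add_eq_zero h.isOpen h.inner_normal_self hx (h.differentiableAt_normal hx)
    (h.differentiableAt_normal hx) v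
  rw [real_inner_comm (N x)] at this
  linarith

lemma inner_param_fderiv_normal (h : IsHypersurfacePatch F N U) (hx : x ∈ U)
    (v : EuclideanSpace ℝ (Fin n)) : ⟪F x, fderiv ℝ N x v⟫_ℝ = 0 := by
  have := inner_fderiv_add_eq_zero h.isOpen h.inner_param_normal hx (h.differentiableAt_param hx)
    (h.differentiableAt_normal hx) v
  rwa [h.inner_fderiv_normal x hx, add_zero] at this

lemma inner_fderiv_param (h : IsHypersurfacePatch F N U) (hx : x ∈ U)
    (v : EuclideanSpace ℝ (Fin n)) : ⟪fderiv ℝ F x v, F x⟫_ℝ = 0 := by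
  rw [real_inner_comm]; exact h.inner_param_fderiv hx v

lemma fderiv_fderiv_apply_const (h : IsHypersurfacePatch F N U) (hx : x ∈ U)
    (u v : EuclideanSpace ℝ (Fin n)) :
    fderiv ℝ (fun y => fderiv ℝ F y v) x u = fderiv ℝ (fderiv ℝ F) x u v := by
  rw [fderiv_clm_apply (h.differentiableAt_fderiv_param hx) (differentiableAt_const v)]
  simp

lemma inner_fderiv_fderiv_param (h : IsHypersurfacePatch F N U) (hx : x ∈ U)
    (u v : EuclideanSpace ℝ (Fin n)) :
    ⟪fderiv ℝ (fderiv ℝ F) x u v, F x⟫_ℝ = -⟪fderiv ℝ F x v, fderiv ℝ F x u⟫_ℝ := by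
  have := inner_fderiv_add_eq_zero (f := fun y => fderiv ℝ F y v) h.isOpen
    (fun y hy => h.inner_fderiv_param hy v) hx
    ((h.differentiableAt_fderiv_param hx).clm_apply (differentiableAt_const v))
    (h.differentiableAt_param hx) u
  rw [h.fderiv_fderiv_apply_const hx] at this
  linarith

variable [CompleteSpace V]

lemma tangentCoord_fderiv (h : IsHypersurfacePatch F N U) (hx : x ∈ U)
    (v : EuclideanSpace ℝ (Fin n)) : tangentCoord (fderiv ℝ F x) (fderiv ℝ F x v) = v :=
  tangentCoord_apply_self (h.injective_fderiv x hx) v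

lemma tangentCoord_param (h : IsHypersurfacePatch F N U) (hx : x ∈ U) :
    tangentCoord (fderiv ℝ F x) (F x) = 0 :=
  tangentCoord_eq_zero (h.inner_fderiv_param hx)

lemma tangentCoord_normal (h : IsHypersurfacePatch F N U) (hx : x ∈ U) :
    tangentCoord (fderiv ℝ F x) (N x) = 0 :=
  tangentCoord_eq_zero (h.inner_fderiv_normal x hx)

lemma contDiffAt_tangentCoord_fderiv (h : IsHypersurfacePatch F N U) (hx : x ∈ U) :
    ContDiffAt ℝ ∞ (fun y => tangentCoord (fderiv ℝ F y)) x :=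
  (contDiffAt_tangentCoord (h.injective_fderiv x hx)).comp x (h.contDiffAt_fderiv_param hx)

lemma differentiableAt_tangentCoord_fderiv (h : IsHypersurfacePatch F N U) (hx : x ∈ U) :
    DifferentiableAt ℝ (fun y => tangentCoord (fderiv ℝ F y)) x :=
  (h.contDiffAt_tangentCoord_fderiv hx).differentiableAt (by simp)

lemma contDiffAt_weingarten (h : IsHypersurfacePatch F N U) (hx : x ∈ U) :
    ContDiffAt ℝ ∞ (weingarten F N) x :=
  ((h.contDiffAt_tangentCoord_fderiv hx).clm_comp (h.contDiffAt_fderiv_normal hx)).neg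

variable [FiniteDimensional ℝ V]

lemma decomposition (h : IsHypersurfacePatch F N U) (hV : Module.finrank ℝ V = n + 2)
    (hx : x ∈ U) (w : V) :
    w = fderiv ℝ F x (tangentCoord (fderiv ℝ F x) w) + ⟪w, F x⟫_ℝ • F x + ⟪w, N x⟫_ℝ • N x :=
  tangentCoord_decomposition hV (h.injective_fderiv x hx) (h.inner_param_self x hx)
    (h.inner_normal_self x hx) (h.inner_param_normal x hx) (h.inner_fderiv_param hx)
    (h.inner_fderiv_normal x hx) w

lemma fderiv_normal (h : IsHypersurfacePatch F N U) (hV : Module.finrank ℝ V = n + 2)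
    (hx : x ∈ U) (v : EuclideanSpace ℝ (Fin n)) :
    fderiv ℝ N x v = -fderiv ℝ F x (weingarten F N x v) := by
  have := h.decomposition hV hx (fderiv ℝ N x v)
  rw [real_inner_comm, h.inner_param_fderiv_normal hx, real_inner_comm,
    h.inner_normal_fderiv hx] at this
  simpa [weingarten] using this

lemma inner_fderiv_fderiv_normal (h : IsHypersurfacePatch F N U)
    (hV : Module.finrank ℝ V = n + 2) (hx : x ∈ U) (u v : EuclideanSpace ℝ (Fin n)) :
    ⟪fderiv ℝ (fderiv ℝ F) x u v, N x⟫_ℝ =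
      ⟪fderiv ℝ F x v, fderiv ℝ F x (weingarten F N x u)⟫_ℝ := by
  have := inner_fderiv_add_eq_zero (f := fun y => fderiv ℝ F y v) h.isOpen
    (fun y hy => h.inner_fderiv_normal y hy v) hx
    ((h.differentiableAt_fderiv_param hx).clm_apply (differentiableAt_const v))
    (h.differentiableAt_normal hx) u
  rw [h.fderiv_fderiv_apply_const hx, h.fderiv_normal hV hx, inner_neg_right] at this
  linarith

/-- Both sides equal $\langle D^2F(u,v),N\rangle$, and the second derivative is symmetric. -/
lemma inner_weingarten_comm (h : IsHypersurfacePatch F N U)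
    (hV : Module.finrank ℝ V = n + 2) (hx : x ∈ U) (u v : EuclideanSpace ℝ (Fin n)) :
    ⟪fderiv ℝ F x (weingarten F N x u), fderiv ℝ F x v⟫_ℝ =
      ⟪fderiv ℝ F x u, fderiv ℝ F x (weingarten F N x v)⟫_ℝ := by
  rw [real_inner_comm, ← h.inner_fderiv_fderiv_normal hV hx, h.fderiv_fderiv_param_comm hx,
    h.inner_fderiv_fderiv_normal hV hx]

end IsHypersurfacePatch

end Patch

/-! ### The Gauss equation and the intrinsic scalar curvature. -/

section Gauss

variable {n : ℕ} {V : Type*} [NormedAddCommGroup V] [InnerProductSpace ℝ V]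
  {F N : EuclideanSpace ℝ (Fin n) → V} {U : Set (EuclideanSpace ℝ (Fin n))}
  {x : EuclideanSpace ℝ (Fin n)}

lemma sum_smul_single (v : EuclideanSpace ℝ (Fin n)) :
    ∑ i, v i • EuclideanSpace.single i (1 : ℝ) = v := by
  ext j
  simp [Finset.sum_apply, Pi.single_apply]

/-- The matrix of an endomorphism of `ℝⁿ` in the standard basis. -/
def stdMatrix (A : EuclideanSpace ℝ (Fin n) →L[ℝ] EuclideanSpace ℝ (Fin n)) :
    Matrix (Fin n) (Fin n) ℝ :=
  Matrix.of fun i j => A (EuclideanSpace.single j 1) i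

lemma apply_eq_sum_stdMatrix (A : EuclideanSpace ℝ (Fin n) →L[ℝ] EuclideanSpace ℝ (Fin n))
    (v : EuclideanSpace ℝ (Fin n)) (i : Fin n) : A v i = ∑ j, stdMatrix A i j * v j := by
  conv_lhs => rw [← sum_smul_single v, map_sum]
  simp [stdMatrix, mul_comm]

lemma stdMatrix_comp (A B : EuclideanSpace ℝ (Fin n) →L[ℝ] EuclideanSpace ℝ (Fin n)) :
    stdMatrix (A ∘L B) = stdMatrix A * stdMatrix B := by
  ext i j
  rw [Matrix.mul_apply]
  simp only [stdMatrix, Matrix.of_apply, ContinuousLinearMap.comp_apply]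
  rw [apply_eq_sum_stdMatrix]
  rfl

lemma metric_apply (i j : Fin n) : metric F x i j =
    ⟪fderiv ℝ F x (EuclideanSpace.single i 1), fderiv ℝ F x (EuclideanSpace.single j 1)⟫_ℝ := rfl

lemma metric_symm (i j : Fin n) : metric F x i j = metric F x j i := by
  rw [metric_apply, metric_apply, real_inner_comm]

lemma metric_mulVec (v : EuclideanSpace ℝ (Fin n)) (i : Fin n) :
    ∑ j, metric F x i j * v j =
      ⟪fderiv ℝ F x (EuclideanSpace.single i 1), fderiv ℝ F x v⟫_ℝ := by
  conv_rhs => rw [← sum_smul_single v]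
  simp [metric_apply, inner_sum, inner_smul_right, mul_comm]

lemma isUnit_metric (hx : Function.Injective (fderiv ℝ F x)) : IsUnit (metric F x) := by
  rw [← Matrix.mulVec_injective_iff_isUnit, ← Matrix.coe_mulVecLin, injective_iff_map_eq_zero]
  intro v hv
  have h0 : ∀ i, ⟪fderiv ℝ F x (EuclideanSpace.single i 1),
      fderiv ℝ F x (WithLp.toLp 2 v)⟫_ℝ = 0 := fun i => by
    rw [← metric_mulVec]; exact congrFun hv i
  have h1 : ⟪fderiv ℝ F x (WithLp.toLp 2 v), fderiv ℝ F x (WithLp.toLp 2 v)⟫_ℝ = 0 := by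
    nth_rewrite 1 [← sum_smul_single (WithLp.toLp 2 v)]
    rw [map_sum, sum_inner]
    refine Finset.sum_eq_zero fun i _ => ?_
    rw [map_smul, inner_smul_left, h0, mul_zero]
  have h2 := (injective_iff_map_eq_zero _).1 hx _ (inner_self_eq_zero.1 h1)
  simpa using congrArg (WithLp.ofLp) h2

lemma metric_inv_mul (hx : Function.Injective (fderiv ℝ F x)) :
    (metric F x)⁻¹ * metric F x = 1 :=
  Matrix.nonsing_inv_mul _ ((Matrix.isUnit_iff_isUnit_det _).1 (isUnit_metric hx))

/-- This ties the coordinate-free projection to the inverse metric in the definitions of the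
Christoffel symbols and the shape matrix. -/
lemma tangentCoord_fderiv_eq_sum [CompleteSpace V] (hx : Function.Injective (fderiv ℝ F x))
    (w : V) (k : Fin n) :
    tangentCoord (fderiv ℝ F x) w k =
      ∑ l, (metric F x)⁻¹ k l * ⟪fderiv ℝ F x (EuclideanSpace.single l 1), w⟫_ℝ := by
  have h : ∀ l, ⟪fderiv ℝ F x (EuclideanSpace.single l 1), w⟫_ℝ =
      ((metric F x).mulVec (tangentCoord (fderiv ℝ F x) w).ofLp) l := fun l => by
    rw [← inner_apply_tangentCoord hx, ← metric_mulVec]; rfl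
  simp_rw [h]
  have := congrFun (Matrix.mulVec_mulVec (tangentCoord (fderiv ℝ F x) w).ofLp
    (metric F x)⁻¹ (metric F x)) k
  rw [metric_inv_mul hx, Matrix.one_mulVec] at this
  exact this.symm

namespace IsHypersurfacePatch

lemma pderiv_pderiv (h : IsHypersurfacePatch F N U) (hx : x ∈ U) (i j : Fin n) :
    pderiv (pderiv F j) i x = fderiv ℝ (fderiv ℝ F) x (EuclideanSpace.single i 1)
      (EuclideanSpace.single j 1) :=
  h.fderiv_fderiv_apply_const hx _ _

lemma pderiv_metric (h : IsHypersurfacePatch F N U) (hx : x ∈ U) (i j l : Fin n) :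
    pderiv (fun y => metric F y j l) i x =
      ⟪fderiv ℝ F x (EuclideanSpace.single j 1),
        fderiv ℝ (fderiv ℝ F) x (EuclideanSpace.single i 1) (EuclideanSpace.single l 1)⟫_ℝ +
      ⟪fderiv ℝ (fderiv ℝ F) x (EuclideanSpace.single i 1) (EuclideanSpace.single j 1),
        fderiv ℝ F x (EuclideanSpace.single l 1)⟫_ℝ := by
  have hd : ∀ v, DifferentiableAt ℝ (fun y => fderiv ℝ F y v) x := fun v =>
    (h.differentiableAt_fderiv_param hx).clm_apply (differentiableAt_const v)
  simp only [pderiv, metric_apply]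
  rw [fderiv_inner_apply ℝ (hd _) (hd _), h.fderiv_fderiv_apply_const hx,
    h.fderiv_fderiv_apply_const hx]

/-- Third derivatives of $F$ are symmetric, so they cancel from the antisymmetrized derivative of
the Christoffel symbols. -/
lemma fderiv_third_comm (h : IsHypersurfacePatch F N U) (hx : x ∈ U)
    (u v w : EuclideanSpace ℝ (Fin n)) :
    fderiv ℝ (fun y => fderiv ℝ (fderiv ℝ F) y u w) x v =
      fderiv ℝ (fun y => fderiv ℝ (fderiv ℝ F) y v w) x u := by
  have hG : ContDiffAt ℝ ∞ (fun y => fderiv ℝ F y w) x :=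
    (h.contDiffAt_fderiv_param hx).clm_apply contDiffAt_const
  have hs := hG.isSymmSndFDerivAt minSmoothness_two_le_infty
  have hG' : DifferentiableAt ℝ (fderiv ℝ (fun y => fderiv ℝ F y w)) x :=
    (hG.fderiv_right (m := ∞) (by simp)).differentiableAt (by simp)
  have key : ∀ u v, fderiv ℝ (fun y => fderiv ℝ (fderiv ℝ F) y u w) x v =
      fderiv ℝ (fderiv ℝ (fun y => fderiv ℝ F y w)) x v u := fun u v => by
    have he : (fun y => fderiv ℝ (fderiv ℝ F) y u w) =ᶠ[nhds x]
        fun y => fderiv ℝ (fun y => fderiv ℝ F y w) y u := by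
      filter_upwards [h.isOpen.mem_nhds hx] with y hy
      rw [h.fderiv_fderiv_apply_const hy]
    rw [he.fderiv_eq, fderiv_clm_apply hG' (differentiableAt_const u)]
    simp
  rw [key, key, hs]

variable [CompleteSpace V]

/-- When each metric derivative is expanded by the product rule, the combination
$\partial_ig_{jl}+\partial_jg_{il}-\partial_lg_{ij}$ collapses to
$2\langle\partial_i\partial_jF,\partial_lF\rangle$. -/
lemma christoffel_eq (h : IsHypersurfacePatch F N U) (hx : x ∈ U) (k i j : Fin n) :
    christoffel F k i j x = tangentCoord (fderiv ℝ F x)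
      (fderiv ℝ (fderiv ℝ F) x (EuclideanSpace.single i 1) (EuclideanSpace.single j 1)) k := by
  rw [tangentCoord_fderiv_eq_sum (h.injective_fderiv x hx), christoffel, Finset.mul_sum]
  refine Finset.sum_congr rfl fun l _ => ?_
  rw [h.pderiv_metric hx, h.pderiv_metric hx, h.pderiv_metric hx,
    h.fderiv_fderiv_param_comm hx (EuclideanSpace.single l 1),
    h.fderiv_fderiv_param_comm hx (EuclideanSpace.single l 1),
    h.fderiv_fderiv_param_comm hx (EuclideanSpace.single j 1) (EuclideanSpace.single i 1)]
  simp only [real_inner_comm (fderiv ℝ F x (EuclideanSpace.single l 1)),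
    real_inner_comm (fderiv ℝ F x (EuclideanSpace.single j 1))
      (fderiv ℝ (fderiv ℝ F) x (EuclideanSpace.single i 1) (EuclideanSpace.single l 1))]
  ring

/-- With $T$ the tangential projection, this and the next two lemmas differentiate $T(dF\,v)=v$,
$T(F)=0$ and $T(N)=0$. Together they determine $DT$ on the tangent, radial and normal parts of an
ambient vector. -/
lemma fderiv_tangentCoord_fderiv (h : IsHypersurfacePatch F N U) (hx : x ∈ U)
    (u v : EuclideanSpace ℝ (Fin n)) :
    fderiv ℝ (fun y => tangentCoord (fderiv ℝ F y)) x u (fderiv ℝ F x v) =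
      -tangentCoord (fderiv ℝ F x) (fderiv ℝ (fderiv ℝ F) x u v) := by
  have he : (fun y => tangentCoord (fderiv ℝ F y) (fderiv ℝ F y v)) =ᶠ[nhds x] fun _ => v := by
    filter_upwards [h.isOpen.mem_nhds hx] with y hy using h.tangentCoord_fderiv hy v
  have := congrArg (fun D => D u) (he.fderiv_eq (𝕜 := ℝ))
  rw [fderiv_clm_apply (h.differentiableAt_tangentCoord_fderiv hx)
    ((h.differentiableAt_fderiv_param hx).clm_apply (differentiableAt_const v))] at this
  simp only [add_apply, ContinuousLinearMap.comp_apply,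
    ContinuousLinearMap.flip_apply, h.fderiv_fderiv_apply_const hx] at this
  rw [eq_neg_iff_add_eq_zero, add_comm, this]
  simp

lemma fderiv_tangentCoord_param (h : IsHypersurfacePatch F N U) (hx : x ∈ U)
    (u : EuclideanSpace ℝ (Fin n)) :
    fderiv ℝ (fun y => tangentCoord (fderiv ℝ F y)) x u (F x) = -u := by
  have he : (fun y => tangentCoord (fderiv ℝ F y) (F y)) =ᶠ[nhds x] fun _ => 0 := by
    filter_upwards [h.isOpen.mem_nhds hx] with y hy using h.tangentCoord_param hy
  have := congrArg (fun D => D u) (he.fderiv_eq (𝕜 := ℝ))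
  rw [fderiv_clm_apply (h.differentiableAt_tangentCoord_fderiv hx)
    (h.differentiableAt_param hx)] at this
  simp only [add_apply, ContinuousLinearMap.comp_apply,
    ContinuousLinearMap.flip_apply, h.tangentCoord_fderiv hx] at this
  rw [eq_neg_iff_add_eq_zero, add_comm, this]
  simp

lemma fderiv_tangentCoord_normal (h : IsHypersurfacePatch F N U) (hx : x ∈ U)
    (u : EuclideanSpace ℝ (Fin n)) :
    fderiv ℝ (fun y => tangentCoord (fderiv ℝ F y)) x u (N x) = weingarten F N x u := by
  have he : (fun y => tangentCoord (fderiv ℝ F y) (N y)) =ᶠ[nhds x] fun _ => 0 := by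
    filter_upwards [h.isOpen.mem_nhds hx] with y hy using h.tangentCoord_normal hy
  have := congrArg (fun D => D u) (he.fderiv_eq (𝕜 := ℝ))
  rw [fderiv_clm_apply (h.differentiableAt_tangentCoord_fderiv hx)
    (h.differentiableAt_normal hx)] at this
  simp only [add_apply, ContinuousLinearMap.comp_apply,
    ContinuousLinearMap.flip_apply] at this
  simp only [weingarten, neg_apply, ContinuousLinearMap.comp_apply]
  rw [eq_neg_iff_add_eq_zero, add_comm, this]
  simp

variable [FiniteDimensional ℝ V]

lemma secondFundamentalForm_apply (h : IsHypersurfacePatch F N U)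
    (hV : Module.finrank ℝ V = n + 2) (hx : x ∈ U) (i j : Fin n) :
    secondFundamentalForm F x (N x) i j =
      ⟪fderiv ℝ F x (EuclideanSpace.single i 1),
        fderiv ℝ F x (weingarten F N x (EuclideanSpace.single j 1))⟫_ℝ := by
  rw [secondFundamentalForm, Matrix.of_apply, h.pderiv_pderiv hx, h.fderiv_fderiv_param_comm hx,
    h.inner_fderiv_fderiv_normal hV hx]

lemma secondFundamentalForm_symm (h : IsHypersurfacePatch F N U)
    (hV : Module.finrank ℝ V = n + 2) (hx : x ∈ U) (i j : Fin n) :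
    secondFundamentalForm F x (N x) i j = secondFundamentalForm F x (N x) j i := by
  rw [h.secondFundamentalForm_apply hV hx, h.secondFundamentalForm_apply hV hx,
    ← h.inner_weingarten_comm hV hx, real_inner_comm]

lemma secondFundamentalForm_eq (h : IsHypersurfacePatch F N U)
    (hV : Module.finrank ℝ V = n + 2) (hx : x ∈ U) :
    secondFundamentalForm F x (N x) = metric F x * stdMatrix (weingarten F N x) := by
  ext i j
  rw [h.secondFundamentalForm_apply hV hx, ← metric_mulVec, Matrix.mul_apply]
  rfl

lemma shapeMatrix_eq (h : IsHypersurfacePatch F N U)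
    (hV : Module.finrank ℝ V = n + 2) (hx : x ∈ U) :
    shapeMatrix F x (N x) = stdMatrix (weingarten F N x) := by
  rw [shapeMatrix, h.secondFundamentalForm_eq hV hx, ← mul_assoc,
    metric_inv_mul (h.injective_fderiv x hx), one_mul]

/-- The product rule for $\Gamma=T(D^2F)$ gives $T(D^3F)$ plus $DT$ applied to $D^2F$. The
tangential part of $D^2F$ yields the quadratic term in $\Gamma$, the normal part the second
fundamental form, and the radial part the metric, which is the curvature of the ambient sphere. -/
lemma pderiv_christoffel (h : IsHypersurfacePatch F N U)
    (hV : Module.finrank ℝ V = n + 2) (hx : x ∈ U) (l k i j : Fin n) :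
    pderiv (christoffel F l j k) i x =
      tangentCoord (fderiv ℝ F x) (fderiv ℝ (fun y => fderiv ℝ (fderiv ℝ F) y
        (EuclideanSpace.single j 1) (EuclideanSpace.single k 1)) x (EuclideanSpace.single i 1)) l
      - ∑ m, christoffel F l i m x * christoffel F m j k x
      + secondFundamentalForm F x (N x) j k * stdMatrix (weingarten F N x) l i
      + metric F x j k * (1 : Matrix (Fin n) (Fin n) ℝ) l i := by
  set e : Fin n → EuclideanSpace ℝ (Fin n) := fun i => EuclideanSpace.single i 1 with he
  have hD2 : DifferentiableAt ℝ (fun y => fderiv ℝ (fderiv ℝ F) y (e j) (e k)) x :=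
    ((((h.contDiffAt_fderiv_param hx).fderiv_right (m := ∞) (by simp)).clm_apply
      contDiffAt_const).clm_apply contDiffAt_const).differentiableAt (by simp)
  have hcongr : christoffel F l j k =ᶠ[nhds x] fun y =>
      EuclideanSpace.proj (𝕜 := ℝ) l
        (tangentCoord (fderiv ℝ F y) (fderiv ℝ (fderiv ℝ F) y (e j) (e k))) := by
    filter_upwards [h.isOpen.mem_nhds hx] with y hy
    rw [h.christoffel_eq hy]; rfl
  have hprod : fderiv ℝ (fun y => tangentCoord (fderiv ℝ F y)
        (fderiv ℝ (fderiv ℝ F) y (e j) (e k))) x (e i) =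
      tangentCoord (fderiv ℝ F x)
        (fderiv ℝ (fun y => fderiv ℝ (fderiv ℝ F) y (e j) (e k)) x (e i)) +
      fderiv ℝ (fun y => tangentCoord (fderiv ℝ F y)) x (e i)
        (fderiv ℝ (fderiv ℝ F) x (e j) (e k)) := by
    rw [fderiv_clm_apply (h.differentiableAt_tangentCoord_fderiv hx) hD2]
    rfl
  have hdec := h.decomposition hV hx (fderiv ℝ (fderiv ℝ F) x (e j) (e k))
  set Γ := tangentCoord (fderiv ℝ F x) (fderiv ℝ (fderiv ℝ F) x (e j) (e k)) with hΓ
  have hΓm : ∀ m, Γ m = christoffel F m j k x := fun m => by rw [h.christoffel_eq hx]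
  have hlin : tangentCoord (fderiv ℝ F x) (fderiv ℝ (fderiv ℝ F) x (e i) Γ) l =
      ∑ m, christoffel F l i m x * christoffel F m j k x := by
    rw [← sum_smul_single Γ]
    simp only [map_sum, map_smul, PiLp.smul_apply, smul_eq_mul, hΓm, h.christoffel_eq hx l i,
      WithLp.ofLp_sum, Finset.sum_apply, mul_comm]
    rfl
  have hh : ⟪fderiv ℝ (fderiv ℝ F) x (e j) (e k), N x⟫_ℝ =
      secondFundamentalForm F x (N x) j k := by
    rw [secondFundamentalForm, Matrix.of_apply, h.pderiv_pderiv hx]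
  have hg : ⟪fderiv ℝ (fderiv ℝ F) x (e j) (e k), F x⟫_ℝ = -metric F x j k := by
    rw [h.inner_fderiv_fderiv_param hx, metric_symm, metric_apply]
  have hpd : pderiv (christoffel F l j k) i x = (fderiv ℝ (fun y => tangentCoord (fderiv ℝ F y)
      (fderiv ℝ (fderiv ℝ F) y (e j) (e k))) x (e i)) l := by
    rw [pderiv, hcongr.fderiv_eq]
    have hd := (h.differentiableAt_tangentCoord_fderiv hx).clm_apply hD2
    have := ((EuclideanSpace.proj (𝕜 := ℝ) l).hasFDerivAt.comp x hd.hasFDerivAt).fderiv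
    rw [Function.comp_def] at this
    rw [this]; rfl
  rw [hpd, hprod, hdec, hh, hg, ← hlin]
  simp only [map_add, map_smul, h.fderiv_tangentCoord_fderiv hx, h.fderiv_tangentCoord_param hx,
    h.fderiv_tangentCoord_normal hx, PiLp.add_apply, PiLp.smul_apply, PiLp.neg_apply,
    smul_eq_mul, stdMatrix, Matrix.of_apply, Matrix.one_apply, he, PiLp.single_apply]
  ring

/-- The Gauss equation for a hypersurface of the unit sphere. -/
lemma riemann_eq (h : IsHypersurfacePatch F N U)
    (hV : Module.finrank ℝ V = n + 2) (hx : x ∈ U) (l k i j : Fin n) :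
    riemann F l k i j x =
      secondFundamentalForm F x (N x) j k * stdMatrix (weingarten F N x) l i
      - secondFundamentalForm F x (N x) i k * stdMatrix (weingarten F N x) l j
      + metric F x j k * (1 : Matrix (Fin n) (Fin n) ℝ) l i
      - metric F x i k * (1 : Matrix (Fin n) (Fin n) ℝ) l j := by
  rw [riemann, h.pderiv_christoffel hV hx, h.pderiv_christoffel hV hx, h.fderiv_third_comm hx,
    Finset.sum_sub_distrib]
  ring

/-- The scalar curvature of a hypersurface of the unit sphere, by the Gauss equation. -/
lemma scalarCurvature_eq (h : IsHypersurfacePatch F N U)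
    (hV : Module.finrank ℝ V = n + 2) (hx : x ∈ U) :
    scalarCurvature F x = (stdMatrix (weingarten F N x)).trace ^ 2
      - (stdMatrix (weingarten F N x) * stdMatrix (weingarten F N x)).trace
      + (n : ℝ) * (n - 1) := by
  set a := stdMatrix (weingarten F N x) with ha
  set s := secondFundamentalForm F x (N x) with hs
  set g := metric F x with hg
  have hinv := metric_inv_mul (h.injective_fderiv x hx)
  have hsa : g⁻¹ * s = a := h.shapeMatrix_eq hV hx
  have hss : ∀ i j, s i j = s j i := h.secondFundamentalForm_symm hV hx
  have hgs : ∀ i j, g i j = g j i := metric_symm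
  have hric : ∀ j k, ricci F j k x = a.trace * s k j - (s * a) k j + (n - 1) * g k j := by
    intro j k
    simp only [ricci, h.riemann_eq hV hx, Finset.sum_add_distrib, Finset.sum_sub_distrib]
    have e1 : ∑ i, s j k * a i i = a.trace * s k j := by
      rw [← Finset.mul_sum, mul_comm, hss]; rfl
    have e2 : ∑ i, s i k * a i j = (s * a) k j := by
      rw [Matrix.mul_apply]
      exact Finset.sum_congr rfl fun i _ => by rw [hss]
    have e3 : ∑ i, g j k * (1 : Matrix (Fin n) (Fin n) ℝ) i i = n * g k j := by
      rw [← Finset.mul_sum, hgs]; simp [mul_comm]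
    have e4 : ∑ i, g i k * (1 : Matrix (Fin n) (Fin n) ℝ) i j = g k j := by
      rw [hgs]; simp [Matrix.one_apply]
    rw [e1, e2, e3, e4]; ring
  have htr : ∀ m : Matrix (Fin n) (Fin n) ℝ, ∑ j, ∑ k, g⁻¹ j k * m k j = (g⁻¹ * m).trace :=
    fun m => by simp [Matrix.trace, Matrix.mul_apply]
  have hsplit : scalarCurvature F x = a.trace * (g⁻¹ * s).trace - (g⁻¹ * (s * a)).trace
      + (n - 1) * (g⁻¹ * g).trace := by
    simp only [← htr, scalarCurvature, hric, Finset.mul_sum, ← Finset.sum_add_distrib,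
      ← Finset.sum_sub_distrib]
    exact Finset.sum_congr rfl fun j _ => Finset.sum_congr rfl fun k _ => by ring
  rw [hsplit, ← mul_assoc, hsa, hinv, Matrix.trace_one, Fintype.card_fin]
  ring

end IsHypersurfacePatch

end Gauss

/-! ### Traces of families of endomorphisms. -/

section Trace

variable {n : ℕ}

/-- The trace, as a continuous linear functional on the endomorphisms of `ℝⁿ`. -/
def traceCLM (n : ℕ) :
    (EuclideanSpace ℝ (Fin n) →L[ℝ] EuclideanSpace ℝ (Fin n)) →L[ℝ] ℝ :=
  ∑ i, (EuclideanSpace.proj (𝕜 := ℝ) i) ∘L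
    (ContinuousLinearMap.apply ℝ (EuclideanSpace ℝ (Fin n)) (EuclideanSpace.single i (1 : ℝ)))

lemma traceCLM_apply (A : EuclideanSpace ℝ (Fin n) →L[ℝ] EuclideanSpace ℝ (Fin n)) :
    traceCLM n A = (stdMatrix A).trace := by
  simp [traceCLM, stdMatrix, Matrix.trace]

lemma stdMatrix_mul (A B : EuclideanSpace ℝ (Fin n) →L[ℝ] EuclideanSpace ℝ (Fin n)) :
    stdMatrix (A * B) = stdMatrix A * stdMatrix B := stdMatrix_comp A B

lemma traceCLM_mul_comm (A B : EuclideanSpace ℝ (Fin n) →L[ℝ] EuclideanSpace ℝ (Fin n)) :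
    traceCLM n (A * B) = traceCLM n (B * A) := by
  rw [traceCLM_apply, traceCLM_apply, stdMatrix_mul, stdMatrix_mul, Matrix.trace_mul_comm]

/-- The derivative of the trace of a family of endomorphisms vanishes where the trace is
constant. -/
lemma traceCLM_fderiv_eq_zero {E : Type*} [NormedAddCommGroup E] [NormedSpace ℝ E]
    {B : E → EuclideanSpace ℝ (Fin n) →L[ℝ] EuclideanSpace ℝ (Fin n)} {U : Set E}
    (hU : IsOpen U) {c : ℝ} (hB : ∀ y ∈ U, traceCLM n (B y) = c) {x : E} (hx : x ∈ U)
    (hd : DifferentiableAt ℝ B x) (v : E) : traceCLM n (fderiv ℝ B x v) = 0 := by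
  have he : (fun y => traceCLM n (B y)) =ᶠ[nhds x] fun _ => c := by
    filter_upwards [hU.mem_nhds hx] with y hy using hB y hy
  have h1 := ((traceCLM n).hasFDerivAt.comp x hd.hasFDerivAt).fderiv
  rw [Function.comp_def, he.fderiv_eq] at h1
  have := congrArg (fun D => D v) h1
  simpa using this.symm

end Trace

/-! ### The nullity field and its splitting tensor. -/

section Nullity

variable {n : ℕ} {V : Type*} [NormedAddCommGroup V] [InnerProductSpace ℝ V] [CompleteSpace V]

/-- `X` is a smooth field, of unit length in the induced metric, that spans the kernel of the
Weingarten map at every point of `U`. -/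
structure IsNullityField (F N : EuclideanSpace ℝ (Fin n) → V)
    (X : EuclideanSpace ℝ (Fin n) → EuclideanSpace ℝ (Fin n))
    (U : Set (EuclideanSpace ℝ (Fin n))) : Prop extends IsHypersurfacePatch F N U where
  contDiffAt_field : ∀ x ∈ U, ContDiffAt ℝ ∞ X x
  weingarten_field : ∀ x ∈ U, weingarten F N x (X x) = 0
  inner_field_self : ∀ x ∈ U, ⟪fderiv ℝ F x (X x), fderiv ℝ F x (X x)⟫_ℝ = 1
  eq_zero_of_weingarten : ∀ x ∈ U, ∀ u, weingarten F N x u = 0 →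
    ⟪fderiv ℝ F x (X x), fderiv ℝ F x u⟫_ℝ = 0 → u = 0

/-- The unit tangent vector in `V` represented by the coordinate field `X`. -/
def ambientField (F : EuclideanSpace ℝ (Fin n) → V)
    (X : EuclideanSpace ℝ (Fin n) → EuclideanSpace ℝ (Fin n)) (x : EuclideanSpace ℝ (Fin n)) : V :=
  fderiv ℝ F x (X x)

/-- The covariant derivative `v ↦ ∇_v X` of the coordinate field `X`. -/
def splittingTensor (F : EuclideanSpace ℝ (Fin n) → V)
    (X : EuclideanSpace ℝ (Fin n) → EuclideanSpace ℝ (Fin n)) (x : EuclideanSpace ℝ (Fin n)) :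
    EuclideanSpace ℝ (Fin n) →L[ℝ] EuclideanSpace ℝ (Fin n) :=
  tangentCoord (fderiv ℝ F x) ∘L fderiv ℝ (ambientField F X) x

namespace IsNullityField

variable {F N : EuclideanSpace ℝ (Fin n) → V}
  {X : EuclideanSpace ℝ (Fin n) → EuclideanSpace ℝ (Fin n)}
  {U : Set (EuclideanSpace ℝ (Fin n))} {x : EuclideanSpace ℝ (Fin n)}

lemma differentiableAt_field (h : IsNullityField F N X U) (hx : x ∈ U) :
    DifferentiableAt ℝ X x := (h.contDiffAt_field x hx).differentiableAt (by simp)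

lemma contDiffAt_ambientField (h : IsNullityField F N X U) (hx : x ∈ U) :
    ContDiffAt ℝ ∞ (ambientField F X) x :=
  (h.contDiffAt_fderiv_param hx).clm_apply (h.contDiffAt_field x hx)

lemma differentiableAt_ambientField (h : IsNullityField F N X U) (hx : x ∈ U) :
    DifferentiableAt ℝ (ambientField F X) x :=
  (h.contDiffAt_ambientField hx).differentiableAt (by simp)

lemma contDiffAt_fderiv_ambientField (h : IsNullityField F N X U) (hx : x ∈ U) :
    ContDiffAt ℝ ∞ (fderiv ℝ (ambientField F X)) x :=
  (h.contDiffAt_ambientField hx).fderiv_right (by simp)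

lemma differentiableAt_fderiv_ambientField (h : IsNullityField F N X U) (hx : x ∈ U) :
    DifferentiableAt ℝ (fderiv ℝ (ambientField F X)) x :=
  (h.contDiffAt_fderiv_ambientField hx).differentiableAt (by simp)

lemma differentiableAt_weingarten (h : IsNullityField F N X U) (hx : x ∈ U) :
    DifferentiableAt ℝ (weingarten F N) x :=
  (h.contDiffAt_weingarten hx).differentiableAt (by simp)

lemma differentiableAt_splittingTensor (h : IsNullityField F N X U) (hx : x ∈ U) :
    DifferentiableAt ℝ (splittingTensor F X) x :=
  ((h.contDiffAt_tangentCoord_fderiv hx).clm_comp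
    (h.contDiffAt_fderiv_ambientField hx)).differentiableAt (by simp)

lemma inner_ambientField_normal (h : IsNullityField F N X U) (hx : x ∈ U) :
    ⟪ambientField F X x, N x⟫_ℝ = 0 := h.inner_fderiv_normal x hx _

lemma inner_ambientField_param (h : IsNullityField F N X U) (hx : x ∈ U) :
    ⟪ambientField F X x, F x⟫_ℝ = 0 := h.inner_fderiv_param hx _

lemma fderiv_ambientField (h : IsNullityField F N X U) (hx : x ∈ U)
    (v : EuclideanSpace ℝ (Fin n)) :
    fderiv ℝ (ambientField F X) x v =
      fderiv ℝ F x (fderiv ℝ X x v) + fderiv ℝ (fderiv ℝ F) x v (X x) := by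
  have : ambientField F X = fun y => fderiv ℝ F y (X y) := rfl
  rw [this, fderiv_clm_apply (h.differentiableAt_fderiv_param hx) (h.differentiableAt_field hx)]
  simp

lemma inner_fderiv_ambientField_param (h : IsNullityField F N X U) (hx : x ∈ U)
    (v : EuclideanSpace ℝ (Fin n)) : ⟪fderiv ℝ (ambientField F X) x v, F x⟫_ℝ =
      -⟪ambientField F X x, fderiv ℝ F x v⟫_ℝ := by
  have := inner_fderiv_add_eq_zero h.isOpen (fun y hy => h.inner_ambientField_param hy) hx
    (h.differentiableAt_ambientField hx) (h.differentiableAt_param hx) v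
  linarith

lemma inner_fderiv_ambientField_self (h : IsNullityField F N X U) (hx : x ∈ U)
    (v : EuclideanSpace ℝ (Fin n)) :
    ⟪ambientField F X x, fderiv ℝ (ambientField F X) x v⟫_ℝ = 0 := by
  have := inner_fderiv_add_eq_zero h.isOpen h.inner_field_self hx
    (h.differentiableAt_ambientField hx) (h.differentiableAt_ambientField hx) v
  change ⟪ambientField F X x, fderiv ℝ (ambientField F X) x v⟫_ℝ +
    ⟪fderiv ℝ (ambientField F X) x v, ambientField F X x⟫_ℝ = 0 at this
  rw [real_inner_comm (ambientField F X x)] at this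
  linarith

variable [FiniteDimensional ℝ V]

lemma fderiv_normal_field (h : IsNullityField F N X U) (hV : Module.finrank ℝ V = n + 2)
    (hx : x ∈ U) : fderiv ℝ N x (X x) = 0 := by
  rw [h.fderiv_normal hV hx, h.weingarten_field x hx, map_zero, neg_zero]

lemma inner_ambientField_weingarten (h : IsNullityField F N X U)
    (hV : Module.finrank ℝ V = n + 2) (hx : x ∈ U) (v : EuclideanSpace ℝ (Fin n)) :
    ⟪ambientField F X x, fderiv ℝ F x (weingarten F N x v)⟫_ℝ = 0 := by
  rw [ambientField, ← h.inner_weingarten_comm hV hx, h.weingarten_field x hx, map_zero,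
    inner_zero_left]

lemma inner_ambientField_fderiv_normal (h : IsNullityField F N X U)
    (hV : Module.finrank ℝ V = n + 2) (hx : x ∈ U) (v : EuclideanSpace ℝ (Fin n)) :
    ⟪ambientField F X x, fderiv ℝ N x v⟫_ℝ = 0 := by
  rw [h.fderiv_normal hV hx, inner_neg_right, h.inner_ambientField_weingarten hV hx, neg_zero]

lemma fderiv_fderiv_normal_field (h : IsNullityField F N X U)
    (hV : Module.finrank ℝ V = n + 2) (hx : x ∈ U) (v : EuclideanSpace ℝ (Fin n)) :
    fderiv ℝ (fderiv ℝ N) x v (X x) = -fderiv ℝ N x (fderiv ℝ X x v) := by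
  have he : (fun y => fderiv ℝ N y (X y)) =ᶠ[nhds x] fun _ => 0 := by
    filter_upwards [h.isOpen.mem_nhds hx] with y hy using h.fderiv_normal_field hV hy
  have := congrArg (fun D => D v) (he.fderiv_eq (𝕜 := ℝ))
  rw [fderiv_clm_apply (h.differentiableAt_fderiv_normal hx) (h.differentiableAt_field hx)] at this
  simp only [add_apply, ContinuousLinearMap.comp_apply, ContinuousLinearMap.flip_apply] at this
  rw [eq_neg_iff_add_eq_zero, add_comm, this]
  simp

lemma inner_fderiv_ambientField_normal (h : IsNullityField F N X U)
    (hV : Module.finrank ℝ V = n + 2) (hx : x ∈ U)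
    (v : EuclideanSpace ℝ (Fin n)) : ⟪fderiv ℝ (ambientField F X) x v, N x⟫_ℝ = 0 := by
  have := inner_fderiv_add_eq_zero h.isOpen (fun y hy => h.inner_ambientField_normal hy) hx
    (h.differentiableAt_ambientField hx) (h.differentiableAt_normal hx) v
  rwa [h.inner_ambientField_fderiv_normal hV hx, zero_add] at this

/-- Moves a derivative from the nullity field onto $dN$, whose derivative is symmetric. This
symmetry is the form in which the Codazzi equation is used. -/
lemma inner_fderiv_ambientField_fderiv_normal (h : IsNullityField F N X U)
    (hV : Module.finrank ℝ V = n + 2) (hx : x ∈ U) (u v : EuclideanSpace ℝ (Fin n)) :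
    ⟪fderiv ℝ (ambientField F X) x u, fderiv ℝ N x v⟫_ℝ =
      -⟪ambientField F X x, fderiv ℝ (fderiv ℝ N) x u v⟫_ℝ := by
  have := inner_fderiv_add_eq_zero (g := fun y => fderiv ℝ N y v) h.isOpen
    (fun y hy => h.inner_ambientField_fderiv_normal hV hy v) hx
    (h.differentiableAt_ambientField hx)
    ((h.differentiableAt_fderiv_normal hx).clm_apply (differentiableAt_const v)) u
  rw [fderiv_clm_apply (h.differentiableAt_fderiv_normal hx) (differentiableAt_const v)] at this
  simp only [add_apply, ContinuousLinearMap.comp_apply, ContinuousLinearMap.flip_apply,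
    fderiv_fun_const, Pi.zero_apply, zero_apply, map_zero, zero_add] at this
  linarith

/-- The integral curves of the nullity field are great circles. -/
lemma fderiv_ambientField_field (h : IsNullityField F N X U)
    (hV : Module.finrank ℝ V = n + 2) (hx : x ∈ U) :
    fderiv ℝ (ambientField F X) x (X x) = -F x := by
  set w := fderiv ℝ (ambientField F X) x (X x) with hw
  have hwF : ⟪w, F x⟫_ℝ = -1 := by
    rw [hw, h.inner_fderiv_ambientField_param hx]
    exact congrArg Neg.neg (h.inner_field_self x hx)
  have hwN : ⟪w, N x⟫_ℝ = 0 := h.inner_fderiv_ambientField_normal hV hx _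
  have hdec := h.decomposition hV hx w
  set u := tangentCoord (fderiv ℝ F x) w with hu
  have hdu : fderiv ℝ F x u = w + F x := by
    rw [hwF, hwN, zero_smul, add_zero, neg_one_smul] at hdec
    rw [hdec]; abel
  have hTu : ⟪fderiv ℝ F x (X x), fderiv ℝ F x u⟫_ℝ = 0 := by
    rw [hdu, inner_add_right]
    have h1 := h.inner_fderiv_ambientField_self hx (X x)
    have h2 := h.inner_ambientField_param hx
    rw [ambientField] at h1 h2
    rw [h2, hw, h1, add_zero]
  -- The tangential part $u$ of $D_XX$ lies in $\ker A$: pairing it with $dN\,v$ and using the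
  -- symmetry of $D^2N$ replaces $D^2N(X,v)$ by $-dN(D_vX)$, which is orthogonal to the nullity
  -- direction. As $u$ is also orthogonal to $X$ and the kernel is a line, $u=0$.
  have hAu : weingarten F N x u = 0 := by
    have h0 : ∀ v, ⟪fderiv ℝ F x (weingarten F N x u), fderiv ℝ F x v⟫_ℝ = 0 := fun v => by
      have h1 : ⟪w, fderiv ℝ N x v⟫_ℝ = 0 := by
        rw [hw, h.inner_fderiv_ambientField_fderiv_normal hV hx, h.fderiv_fderiv_normal_comm hx,
          h.fderiv_fderiv_normal_field hV hx, inner_neg_right,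
          h.inner_ambientField_fderiv_normal hV hx]
        simp
      rw [h.inner_weingarten_comm hV hx, hdu, ← neg_neg (fderiv ℝ F x (weingarten F N x v)),
        ← h.fderiv_normal hV hx, inner_neg_right, inner_add_left, h1,
        h.inner_param_fderiv_normal hx]
      simp
    exact (injective_iff_map_eq_zero _).1 (h.injective_fderiv x hx) _
      (inner_self_eq_zero.1 (h0 _))
  have hu0 := h.eq_zero_of_weingarten x hx u hAu hTu
  rw [hu0, map_zero] at hdu
  exact eq_neg_of_add_eq_zero_left hdu.symm

/-- The ambient derivative of the nullity field has no component along $N$, so only the radial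
component separates it from $\nabla_vX$. -/
lemma fderiv_splittingTensor (h : IsNullityField F N X U)
    (hV : Module.finrank ℝ V = n + 2) (hx : x ∈ U) (v : EuclideanSpace ℝ (Fin n)) :
    fderiv ℝ F x (splittingTensor F X x v) = fderiv ℝ (ambientField F X) x v +
      ⟪ambientField F X x, fderiv ℝ F x v⟫_ℝ • F x := by
  have hdec := h.decomposition hV hx (fderiv ℝ (ambientField F X) x v)
  rw [h.inner_fderiv_ambientField_param hx, h.inner_fderiv_ambientField_normal hV hx, zero_smul,
    add_zero] at hdec
  rw [splittingTensor, ContinuousLinearMap.comp_apply]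
  nth_rewrite 2 [hdec]
  module

/-- The Codazzi equation in the direction of the nullity field: `A ∘ ∇X` is self-adjoint for the
induced metric. -/
lemma inner_weingarten_splittingTensor_comm (h : IsNullityField F N X U)
    (hV : Module.finrank ℝ V = n + 2) (hx : x ∈ U) (u v : EuclideanSpace ℝ (Fin n)) :
    ⟪fderiv ℝ F x (weingarten F N x (splittingTensor F X x u)), fderiv ℝ F x v⟫_ℝ =
      ⟪fderiv ℝ F x u, fderiv ℝ F x (weingarten F N x (splittingTensor F X x v))⟫_ℝ := by
  -- Each side reduces to $\langle X,D^2N(u,v)\rangle$, which is symmetric in $u$ and $v$.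
  have key : ∀ u v, ⟪fderiv ℝ F x (weingarten F N x (splittingTensor F X x u)),
      fderiv ℝ F x v⟫_ℝ = ⟪ambientField F X x, fderiv ℝ (fderiv ℝ N) x u v⟫_ℝ := fun u v => by
    rw [h.inner_weingarten_comm hV hx, ← neg_neg (fderiv ℝ F x (weingarten F N x v)),
      ← h.fderiv_normal hV hx, inner_neg_right, h.fderiv_splittingTensor hV hx, inner_add_left,
      inner_smul_left, h.inner_param_fderiv_normal hx,
      h.inner_fderiv_ambientField_fderiv_normal hV hx]
    simp
  rw [key, real_inner_comm _ (fderiv ℝ F x u), key, h.fderiv_fderiv_normal_comm hx]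

/-- Obtained by differentiating $dF\circ A=-dN$ along $X$, with $dN(X)=0$ used to rewrite
$D^2N(X,\cdot)$. In terms of the Lie derivative it reads $\mathcal L_XA=-CA$. -/
lemma fderiv_weingarten_field (h : IsNullityField F N X U)
    (hV : Module.finrank ℝ V = n + 2) (hx : x ∈ U) :
    fderiv ℝ (weingarten F N) x (X x) = fderiv ℝ X x * weingarten F N x
      - weingarten F N x * fderiv ℝ X x - splittingTensor F X x * weingarten F N x := by
  ext1 v
  apply h.injective_fderiv x hx
  have he : (fun y => fderiv ℝ F y (weingarten F N y v)) =ᶠ[nhds x]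
      fun y => -fderiv ℝ N y v := by
    filter_upwards [h.isOpen.mem_nhds hx] with y hy
    rw [h.fderiv_normal hV hy, neg_neg]
  have hA : DifferentiableAt ℝ (fun y => weingarten F N y v) x :=
    (h.differentiableAt_weingarten hx).clm_apply (differentiableAt_const v)
  have h1 := congrArg (fun D => D (X x)) (he.fderiv_eq (𝕜 := ℝ))
  rw [fderiv_clm_apply (h.differentiableAt_fderiv_param hx) hA, fderiv_fun_neg,
    fderiv_clm_apply (h.differentiableAt_weingarten hx) (differentiableAt_const v),
    fderiv_clm_apply (h.differentiableAt_fderiv_normal hx) (differentiableAt_const v)] at h1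
  simp only [add_apply, neg_apply, ContinuousLinearMap.comp_apply, ContinuousLinearMap.flip_apply,
    fderiv_fun_const, Pi.zero_apply, zero_apply, map_zero, zero_add] at h1
  rw [h.fderiv_fderiv_param_comm hx, h.fderiv_fderiv_normal_comm hx,
    h.fderiv_fderiv_normal_field hV hx, h.fderiv_normal hV hx] at h1
  have h2 := h.fderiv_ambientField hx (weingarten F N x v)
  have h3 := h.fderiv_splittingTensor hV hx (weingarten F N x v)
  rw [h.inner_ambientField_weingarten hV hx, zero_smul, add_zero] at h3
  simp only [sub_apply, mul_apply_eq_comp, map_sub]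
  rw [h3, h2, eq_sub_of_add_eq h1]
  module

/-- The Riccati equation of the splitting tensor along the nullity field. -/
lemma fderiv_splittingTensor_field (h : IsNullityField F N X U)
    (hV : Module.finrank ℝ V = n + 2) (hx : x ∈ U) :
    ∃ R : EuclideanSpace ℝ (Fin n) →L[ℝ] EuclideanSpace ℝ (Fin n),
      weingarten F N x * R = 0 ∧
      fderiv ℝ (splittingTensor F X) x (X x) = fderiv ℝ X x * splittingTensor F X x
        - splittingTensor F X x * fderiv ℝ X x - splittingTensor F X x * splittingTensor F X x
        - 1 + R := by
  -- $R=\langle X,\cdot\rangle X$ takes values in $\ker A$. With $-1$ it is the curvature term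
  -- $-v+\langle X,v\rangle X$ of the unit sphere.
  refine ⟨((innerSL ℝ (ambientField F X x)) ∘L fderiv ℝ F x).smulRight (X x), ?_, ?_⟩
  · ext1 v
    simp [h.weingarten_field x hx]
  ext1 v
  have he : (fun y => fderiv ℝ F y (splittingTensor F X y v)) =ᶠ[nhds x]
      fun y => fderiv ℝ (ambientField F X) y v +
        ⟪ambientField F X y, fderiv ℝ F y v⟫_ℝ • F y := by
    filter_upwards [h.isOpen.mem_nhds hx] with y hy using h.fderiv_splittingTensor hV hy v
  have hC : DifferentiableAt ℝ (fun y => splittingTensor F X y v) x :=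
    (h.differentiableAt_splittingTensor hx).clm_apply (differentiableAt_const v)
  have hT : DifferentiableAt ℝ (fun y => fderiv ℝ (ambientField F X) y v) x :=
    (h.differentiableAt_fderiv_ambientField hx).clm_apply (differentiableAt_const v)
  have hi : DifferentiableAt ℝ (fun y => ⟪ambientField F X y, fderiv ℝ F y v⟫_ℝ) x :=
    (h.differentiableAt_ambientField hx).inner ℝ
      ((h.differentiableAt_fderiv_param hx).clm_apply (differentiableAt_const v))
  have h1 := congrArg (fun D => D (X x)) (he.fderiv_eq (𝕜 := ℝ))
  rw [fderiv_clm_apply (h.differentiableAt_fderiv_param hx) hC,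
    fderiv_fun_add hT (hi.fun_smul (h.differentiableAt_param hx)),
    fderiv_fun_smul hi (h.differentiableAt_param hx),
    fderiv_clm_apply (h.differentiableAt_splittingTensor hx) (differentiableAt_const v),
    fderiv_clm_apply (h.differentiableAt_fderiv_ambientField hx) (differentiableAt_const v)] at h1
  simp only [add_apply, smul_apply, ContinuousLinearMap.smulRight_apply,
    ContinuousLinearMap.comp_apply, ContinuousLinearMap.flip_apply,
    fderiv_fun_const, Pi.zero_apply, zero_apply, map_zero, zero_add] at h1
  have hsymm : fderiv ℝ (fderiv ℝ (ambientField F X)) x (X x) v =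
      fderiv ℝ (fderiv ℝ (ambientField F X)) x v (X x) :=
    ((h.contDiffAt_ambientField hx).isSymmSndFDerivAt minSmoothness_two_le_infty) _ _
  -- The great-circle equation $D_XX=-F$ holds on an open set and may be differentiated in the
  -- direction $v$.
  have hgeo : fderiv ℝ (fderiv ℝ (ambientField F X)) x v (X x) =
      -fderiv ℝ F x v - fderiv ℝ (ambientField F X) x (fderiv ℝ X x v) := by
    have he' : (fun y => fderiv ℝ (ambientField F X) y (X y)) =ᶠ[nhds x] fun y => -F y := by
      filter_upwards [h.isOpen.mem_nhds hx] with y hy using h.fderiv_ambientField_field hV hy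
    have h2 := congrArg (fun D => D v) (he'.fderiv_eq (𝕜 := ℝ))
    rw [fderiv_clm_apply (h.differentiableAt_fderiv_ambientField hx)
      (h.differentiableAt_field hx), fderiv_fun_neg] at h2
    simp only [add_apply, neg_apply, ContinuousLinearMap.comp_apply,
      ContinuousLinearMap.flip_apply] at h2
    rw [← h2]; abel
  have h4 := h.fderiv_ambientField hx (splittingTensor F X x v)
  rw [hsymm, hgeo, h.fderiv_fderiv_param_comm hx, eq_sub_of_add_eq' h4.symm] at h1
  have h5 := congrArg (tangentCoord (fderiv ℝ F x)) h1
  have hC' : ∀ w, tangentCoord (fderiv ℝ F x) (fderiv ℝ (ambientField F X) x w) =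
      splittingTensor F X x w := fun _ => rfl
  simp only [map_add, map_sub, map_neg, map_smul, h.tangentCoord_fderiv hx,
    h.tangentCoord_param hx, smul_zero, add_zero, hC'] at h5
  simp only [add_apply, sub_apply, mul_apply_eq_comp, one_apply_eq_self, ContinuousLinearMap.smulRight_apply,
    ContinuousLinearMap.comp_apply, innerSL_apply_apply]
  rw [eq_sub_of_add_eq h5]
  module

end IsNullityField

end Nullity

/-! ### Trace identities along the nullity field, and existence of that field. -/

section NullityTraces

variable {n : ℕ} {V : Type*} [NormedAddCommGroup V] [InnerProductSpace ℝ V] [CompleteSpace V]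
  {F N : EuclideanSpace ℝ (Fin n) → V}
  {X : EuclideanSpace ℝ (Fin n) → EuclideanSpace ℝ (Fin n)}
  {U : Set (EuclideanSpace ℝ (Fin n))} {x : EuclideanSpace ℝ (Fin n)}

namespace IsNullityField

variable [FiniteDimensional ℝ V]

/-- The derivative of $\operatorname{tr}A$ along $X$ is $-\operatorname{tr}CA$, since the commutator
of $DX$ with $A$ is traceless. -/
lemma trace_splittingTensor_mul (h : IsNullityField F N X U) (hV : Module.finrank ℝ V = n + 2)
    {c : ℝ} (htr : ∀ y ∈ U, traceCLM n (weingarten F N y) = c) (hx : x ∈ U) :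
    traceCLM n (splittingTensor F X x * weingarten F N x) = 0 := by
  have h1 := traceCLM_fderiv_eq_zero h.isOpen htr hx (h.differentiableAt_weingarten hx) (X x)
  rw [h.fderiv_weingarten_field hV hx] at h1
  simp only [map_sub] at h1
  have e1 := traceCLM_mul_comm (weingarten F N x) (fderiv ℝ X x)
  linarith

/-- By cyclicity the derivative of $\operatorname{tr}A^2$ along $X$ is $-2\operatorname{tr}CA^2$. -/
lemma trace_splittingTensor_mul_sq (h : IsNullityField F N X U)
    (hV : Module.finrank ℝ V = n + 2) {c : ℝ}
    (hsq : ∀ y ∈ U, traceCLM n (weingarten F N y * weingarten F N y) = c) (hx : x ∈ U) :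
    traceCLM n (splittingTensor F X x * weingarten F N x * weingarten F N x) = 0 := by
  have hA := h.differentiableAt_weingarten hx
  have h1 := traceCLM_fderiv_eq_zero h.isOpen hsq hx (hA.fun_mul hA) (X x)
  rw [fderiv_fun_mul' hA hA] at h1
  simp only [add_apply, smul_apply, smul_eq_mul, MulOpposite.smul_eq_mul_unop,
    MulOpposite.unop_op, h.fderiv_weingarten_field hV hx] at h1
  set A := weingarten F N x
  set C := splittingTensor F X x
  set M := fderiv ℝ X x
  simp only [mul_sub, sub_mul, map_add, map_sub, ← mul_assoc] at h1
  have e1 := traceCLM_mul_comm A (C * A)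
  have e2 := traceCLM_mul_comm (A * A) M
  simp only [← mul_assoc] at e1 e2
  linarith

/-- Differentiating $\operatorname{tr}CA=0$ gives
$-2\operatorname{tr}C^2A-\operatorname{tr}A+\operatorname{tr}RA=0$. Here $\operatorname{tr}A$ must
be zero and not merely constant, and $\operatorname{tr}RA=\operatorname{tr}AR=0$. -/
lemma trace_splittingTensor_sq_mul (h : IsNullityField F N X U)
    (hV : Module.finrank ℝ V = n + 2) (htr : ∀ y ∈ U, traceCLM n (weingarten F N y) = 0)
    (hx : x ∈ U) :
    traceCLM n (splittingTensor F X x * splittingTensor F X x * weingarten F N x) = 0 := by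
  have hA := h.differentiableAt_weingarten hx
  have hC := h.differentiableAt_splittingTensor hx
  have h1 := traceCLM_fderiv_eq_zero h.isOpen
    (fun y hy => h.trace_splittingTensor_mul hV htr hy) hx (hC.fun_mul hA) (X x)
  rw [fderiv_fun_mul' hC hA] at h1
  obtain ⟨R, hR, hC'⟩ := h.fderiv_splittingTensor_field hV hx
  have h0 := htr x hx
  simp only [add_apply, smul_apply, smul_eq_mul, MulOpposite.smul_eq_mul_unop,
    MulOpposite.unop_op, h.fderiv_weingarten_field hV hx, hC'] at h1
  set A := weingarten F N x
  set C := splittingTensor F X x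
  set M := fderiv ℝ X x
  simp only [mul_sub, add_mul, sub_mul, map_add, map_sub, one_mul, ← mul_assoc] at h1
  have e1 := traceCLM_mul_comm (C * A) M
  have e2 := traceCLM_mul_comm R A
  rw [hR, map_zero] at e2
  simp only [← mul_assoc] at e1
  linarith

/-- Differentiates $\operatorname{tr}CA^2=0$. The term $\operatorname{tr}A^2$ comes from the $-1$ in
the Riccati equation, that is, from the curvature of the sphere. -/
lemma trace_splittingTensor_sq_mul_sq (h : IsNullityField F N X U)
    (hV : Module.finrank ℝ V = n + 2) {c : ℝ}
    (hsq : ∀ y ∈ U, traceCLM n (weingarten F N y * weingarten F N y) = c) (hx : x ∈ U) :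
    2 * traceCLM n (splittingTensor F X x * splittingTensor F X x *
        weingarten F N x * weingarten F N x) +
      traceCLM n (splittingTensor F X x * weingarten F N x *
        splittingTensor F X x * weingarten F N x) +
      traceCLM n (weingarten F N x * weingarten F N x) = 0 := by
  have hA := h.differentiableAt_weingarten hx
  have hC := h.differentiableAt_splittingTensor hx
  have h1 := traceCLM_fderiv_eq_zero h.isOpen
    (fun y hy => h.trace_splittingTensor_mul_sq hV hsq hy) hx ((hC.fun_mul hA).fun_mul hA) (X x)
  rw [fderiv_fun_mul' (hC.fun_mul hA) hA, fderiv_fun_mul' hC hA] at h1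
  obtain ⟨R, hR, hC'⟩ := h.fderiv_splittingTensor_field hV hx
  simp only [add_apply, smul_apply, smul_eq_mul, MulOpposite.smul_eq_mul_unop,
    MulOpposite.unop_op, h.fderiv_weingarten_field hV hx, hC'] at h1
  set A := weingarten F N x
  set C := splittingTensor F X x
  set M := fderiv ℝ X x
  simp only [mul_sub, add_mul, sub_mul, map_add, map_sub, one_mul, ← mul_assoc] at h1
  have e1 := traceCLM_mul_comm (C * A * A) M
  have e2 := traceCLM_mul_comm (R * A) A
  rw [← mul_assoc, hR, zero_mul, map_zero] at e2
  simp only [← mul_assoc] at e1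
  linarith

end IsNullityField

/-- Where the kernel of the Weingarten map is one-dimensional at a point and nontrivial nearby,
it is spanned by a smooth unit field near that point. -/
lemma IsHypersurfacePatch.exists_nullityField [FiniteDimensional ℝ V]
    (h : IsHypersurfacePatch F N U) (hV : Module.finrank ℝ V = n + 2) (hx : x ∈ U)
    {w : EuclideanSpace ℝ (Fin n)} (hw : w ≠ 0) (hAw : weingarten F N x w = 0)
    (hker : ∀ u, weingarten F N x u = 0 → ⟪fderiv ℝ F x w, fderiv ℝ F x u⟫_ℝ = 0 → u = 0)
    (hdet : ∀ y ∈ U, ∃ u, u ≠ 0 ∧ weingarten F N y u = 0) :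
    ∃ U' ⊆ U, x ∈ U' ∧ ∃ X, IsNullityField F N X U' := by
  set β : EuclideanSpace ℝ (Fin n) →L[ℝ] ℝ := innerSL ℝ (fderiv ℝ F x w) ∘L fderiv ℝ F x with hβ
  -- A rank-one perturbation of $A$ that is invertible at $x$, hence nearby. It sends any $u\in\ker
  -- A$ to $\beta(u)w$, so $\ker A$ lies in the line spanned by $A_1^{-1}w$, which is smooth in $y$.
  -- Nontriviality of the kernel makes this an equality.
  set A₁ : EuclideanSpace ℝ (Fin n) → EuclideanSpace ℝ (Fin n) →L[ℝ] EuclideanSpace ℝ (Fin n) :=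
    fun y => weingarten F N y + β.smulRight w with hA₁
  have hA₁d : ∀ y ∈ U, ContDiffAt ℝ ∞ A₁ y := fun y hy =>
    (h.contDiffAt_weingarten hy).add contDiffAt_const
  have hFw : ⟪fderiv ℝ F x w, fderiv ℝ F x w⟫_ℝ ≠ 0 := fun h0 =>
    hw ((injective_iff_map_eq_zero _).1 (h.injective_fderiv x hx) w (inner_self_eq_zero.1 h0))
  have hunit : IsUnit (A₁ x) := by
    apply isUnit_of_injective
    rw [injective_iff_map_eq_zero]
    intro u hu
    have hu' : weingarten F N x u + β u • w = 0 := hu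
    have h1 := congrArg (fun z => ⟪fderiv ℝ F x z, fderiv ℝ F x w⟫_ℝ) hu'
    simp only [map_add, map_smul, inner_add_left, inner_smul_left, map_zero, inner_zero_left,
      h.inner_weingarten_comm hV hx, hAw, inner_zero_right, zero_add] at h1
    have hβu : β u = 0 := (mul_eq_zero.1 h1).resolve_right hFw
    rw [hβu, zero_smul, add_zero] at hu'
    exact hker u hu' hβu
  set U' := U ∩ A₁ ⁻¹' {B | IsUnit B} with hU'
  have hU'o : IsOpen U' := ContinuousOn.isOpen_inter_preimage
    (fun y hy => (hA₁d y hy).continuousAt.continuousWithinAt) h.isOpen Units.isOpen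
  set Y : EuclideanSpace ℝ (Fin n) → EuclideanSpace ℝ (Fin n) :=
    fun y => Ring.inverse (A₁ y) w with hY
  have hspan : ∀ y ∈ U', ∀ u, weingarten F N y u = 0 → u = β u • Y y := fun y hy u hu => by
    have h1 : A₁ y u = β u • w := by simp [hA₁, hu]
    have h2 := DFunLike.congr_fun (Ring.inverse_mul_cancel _ hy.2) u
    rw [mul_apply_eq_comp, h1, map_smul] at h2
    exact h2.symm
  have hAY : ∀ y ∈ U', weingarten F N y (Y y) = 0 ∧ Y y ≠ 0 := fun y hy => by
    obtain ⟨u, hu0, hu⟩ := hdet y hy.1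
    have hs := hspan y hy u hu
    have hβu : β u ≠ 0 := fun h0 => hu0 (by rw [hs, h0, zero_smul])
    constructor
    · have h1 := hu
      rw [hs, map_smul] at h1
      exact (smul_eq_zero.1 h1).resolve_left hβu
    · intro h0
      rw [h0, smul_zero] at hs
      exact hu0 hs
  have hFY : ∀ y ∈ U', fderiv ℝ F y (Y y) ≠ 0 := fun y hy h0 =>
    (hAY y hy).2 ((injective_iff_map_eq_zero _).1 (h.injective_fderiv y hy.1) _ h0)
  have hYd : ∀ y ∈ U', ContDiffAt ℝ ∞ Y y := fun y hy => by
    obtain ⟨B, hB⟩ := hy.2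
    have hinv : ContDiffAt ℝ ∞ (fun y => Ring.inverse (A₁ y)) y := by
      refine ContDiffAt.comp (g := Ring.inverse) y ?_ (hA₁d y hy.1)
      rw [← hB]
      exact contDiffAt_ringInverse ℝ B
    exact hinv.clm_apply contDiffAt_const
  refine ⟨U', Set.inter_subset_left, ⟨hx, hunit⟩,
    fun y => ‖fderiv ℝ F y (Y y)‖⁻¹ • Y y, ?_⟩
  refine
    { isOpen := hU'o
      contDiffAt_param := fun y hy => h.contDiffAt_param y hy.1
      contDiffAt_normal := fun y hy => h.contDiffAt_normal y hy.1
      injective_fderiv := fun y hy => h.injective_fderiv y hy.1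
      inner_param_self := fun y hy => h.inner_param_self y hy.1
      inner_normal_self := fun y hy => h.inner_normal_self y hy.1
      inner_param_normal := fun y hy => h.inner_param_normal y hy.1
      inner_fderiv_normal := fun y hy => h.inner_fderiv_normal y hy.1
      contDiffAt_field := fun y hy => ?_
      weingarten_field := fun y hy => ?_
      inner_field_self := fun y hy => ?_
      eq_zero_of_weingarten := fun y hy u hu hXu => ?_ }
  · exact ((((h.contDiffAt_fderiv_param hy.1).clm_apply (hYd y hy)).norm ℝ (hFY y hy)).inv
      (norm_ne_zero_iff.2 (hFY y hy))).smul (hYd y hy)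
  · rw [map_smul, (hAY y hy).1, smul_zero]
  · have := norm_ne_zero_iff.2 (hFY y hy)
    rw [map_smul, inner_smul_left, inner_smul_right, real_inner_self_eq_norm_sq]
    simp only [conj_trivial]
    field_simp
  · have hs := hspan y hy u hu
    have hn := norm_ne_zero_iff.2 (hFY y hy)
    rw [hs, map_smul, map_smul, inner_smul_left, inner_smul_right, real_inner_self_eq_norm_sq]
      at hXu
    simp only [conj_trivial, mul_eq_zero, inv_eq_zero, hn, false_or,
      ne_eq, OfNat.ofNat_ne_zero, not_false_eq_true, pow_eq_zero_iff, or_false] at hXu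
    rw [hs, hXu, zero_smul]

end NullityTraces

/-! ### Orthonormal bases of principal directions. -/

section PrincipalBasis

variable {n : ℕ} {V : Type*} [NormedAddCommGroup V] [InnerProductSpace ℝ V] [CompleteSpace V]
  {F N : EuclideanSpace ℝ (Fin n) → V}
  {U : Set (EuclideanSpace ℝ (Fin n))} {x : EuclideanSpace ℝ (Fin n)}

lemma stdMatrix_eq_toMatrix (A : EuclideanSpace ℝ (Fin n) →L[ℝ] EuclideanSpace ℝ (Fin n)) :
    stdMatrix A = LinearMap.toMatrix (EuclideanSpace.basisFun (Fin n) ℝ).toBasis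
      (EuclideanSpace.basisFun (Fin n) ℝ).toBasis A.toLinearMap := by
  ext i j
  simp [LinearMap.toMatrix_apply, stdMatrix]

lemma traceCLM_eq_trace_toMatrix (b : Module.Basis (Fin n) ℝ (EuclideanSpace ℝ (Fin n)))
    (A : EuclideanSpace ℝ (Fin n) →L[ℝ] EuclideanSpace ℝ (Fin n)) :
    traceCLM n A = (LinearMap.toMatrix b b A.toLinearMap).trace := by
  rw [traceCLM_apply, stdMatrix_eq_toMatrix, ← LinearMap.trace_eq_matrix_trace,
    ← LinearMap.trace_eq_matrix_trace]

lemma det_stdMatrix_eq_det_toMatrix (b : Module.Basis (Fin n) ℝ (EuclideanSpace ℝ (Fin n)))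
    (A : EuclideanSpace ℝ (Fin n) →L[ℝ] EuclideanSpace ℝ (Fin n)) :
    (stdMatrix A).det = (LinearMap.toMatrix b b A.toLinearMap).det := by
  rw [stdMatrix_eq_toMatrix, LinearMap.det_toMatrix, LinearMap.det_toMatrix]

lemma finrank_eigenspace_conj {E E' : Type*} [AddCommGroup E] [Module ℝ E] [AddCommGroup E']
    [Module ℝ E'] (e : E ≃ₗ[ℝ] E') (f : Module.End ℝ E) (μ : ℝ) :
    Module.finrank ℝ ((e.conj f).eigenspace μ) = Module.finrank ℝ (f.eigenspace μ) := by
  have : (e.conj f).eigenspace μ = (f.eigenspace μ).map (e : E →ₗ[ℝ] E') := by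
    ext v
    rw [Submodule.mem_map_equiv, Module.End.mem_eigenspace_iff, Module.End.mem_eigenspace_iff,
      LinearEquiv.conj_apply_apply]
    constructor
    · intro h
      rw [← map_smul, ← h, LinearEquiv.symm_apply_apply]
    · intro h
      rw [h, map_smul, LinearEquiv.apply_symm_apply]
  rw [this]
  exact LinearEquiv.finrank_map_eq e _

/-- `b` is a basis of principal directions, orthonormal for the induced metric, with principal
curvatures `d`. -/
structure IsPrincipalBasis (F N : EuclideanSpace ℝ (Fin n) → V) (x : EuclideanSpace ℝ (Fin n))
    (b : Module.Basis (Fin n) ℝ (EuclideanSpace ℝ (Fin n))) (d : Fin n → ℝ) : Prop where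
  weingarten_apply : ∀ i, weingarten F N x (b i) = d i • b i
  inner_apply : ∀ i j, ⟪fderiv ℝ F x (b i), fderiv ℝ F x (b j)⟫_ℝ = if i = j then 1 else 0

namespace IsPrincipalBasis

variable {b : Module.Basis (Fin n) ℝ (EuclideanSpace ℝ (Fin n))} {d : Fin n → ℝ}

lemma reindex (h : IsPrincipalBasis F N x b d) (σ : Equiv.Perm (Fin n)) :
    IsPrincipalBasis F N x (b.reindex σ.symm) (d ∘ σ) where
  weingarten_apply i := by simp [h.weingarten_apply]
  inner_apply i j := by simp [h.inner_apply]

lemma toMatrix_weingarten (h : IsPrincipalBasis F N x b d) :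
    LinearMap.toMatrix b b (weingarten F N x).toLinearMap = Matrix.diagonal d := by
  ext i j
  rw [LinearMap.toMatrix_apply]
  simp only [ContinuousLinearMap.coe_coe, h.weingarten_apply, map_smul, Finsupp.smul_apply,
    Module.Basis.repr_self, Finsupp.single_apply, Matrix.diagonal_apply, smul_eq_mul]
  by_cases hij : i = j
  · subst hij; simp
  · simp [hij, Ne.symm hij]

lemma inner_eq_repr (h : IsPrincipalBasis F N x b d) (v : EuclideanSpace ℝ (Fin n)) (i : Fin n) :
    ⟪fderiv ℝ F x (b i), fderiv ℝ F x v⟫_ℝ = b.repr v i := by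
  conv_lhs => rw [← b.sum_repr v, map_sum, inner_sum]
  simp [inner_smul_right, h.inner_apply]

lemma traceCLM_weingarten (h : IsPrincipalBasis F N x b d) :
    traceCLM n (weingarten F N x) = ∑ i, d i := by
  rw [traceCLM_eq_trace_toMatrix b, h.toMatrix_weingarten, Matrix.trace_diagonal]

lemma traceCLM_weingarten_sq (h : IsPrincipalBasis F N x b d) :
    traceCLM n (weingarten F N x * weingarten F N x) = ∑ i, d i ^ 2 := by
  rw [traceCLM_eq_trace_toMatrix b, ContinuousLinearMap.toLinearMap_mul, LinearMap.toMatrix_mul,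
    h.toMatrix_weingarten, Matrix.diagonal_mul_diagonal, Matrix.trace_diagonal]
  simp [sq]

lemma det_weingarten (h : IsPrincipalBasis F N x b d) :
    (stdMatrix (weingarten F N x)).det = ∏ i, d i := by
  rw [det_stdMatrix_eq_det_toMatrix b, h.toMatrix_weingarten, Matrix.det_diagonal]

end IsPrincipalBasis

lemma toLin'_stdMatrix (A : EuclideanSpace ℝ (Fin n) →L[ℝ] EuclideanSpace ℝ (Fin n))
    (u : Fin n → ℝ) :
    WithLp.toLp 2 (Matrix.toLin' (stdMatrix A) u) = A (WithLp.toLp 2 u) := by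
  ext i
  rw [apply_eq_sum_stdMatrix]
  rfl

/-- The shape operator is carried to the range of $dF$, where the induced metric is the ambient
inner product, and the spectral theorem for symmetric operators applies there. -/
lemma IsHypersurfacePatch.exists_isPrincipalBasis [FiniteDimensional ℝ V]
    (h : IsHypersurfacePatch F N U) (hV : Module.finrank ℝ V = n + 2) (hx : x ∈ U) :
    ∃ b d, IsPrincipalBasis F N x b d ∧ Antitone d ∧
      ∀ μ, Finset.card {i | d i = μ} = principalMultiplicity F x (N x) μ := by
  have hinj : Function.Injective (fderiv ℝ F x).toLinearMap := h.injective_fderiv x hx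
  let ι : EuclideanSpace ℝ (Fin n) ≃ₗ[ℝ] LinearMap.range (fderiv ℝ F x).toLinearMap :=
    LinearEquiv.ofInjective _ hinj
  let ψ : (Fin n → ℝ) ≃ₗ[ℝ] LinearMap.range (fderiv ℝ F x).toLinearMap :=
    (WithLp.linearEquiv 2 ℝ (Fin n → ℝ)).symm ≪≫ₗ ι
  let T := ψ.conj (shapeOperator F x (N x))
  have hι : ∀ u, ((ι u : LinearMap.range (fderiv ℝ F x).toLinearMap) : V) = fderiv ℝ F x u :=
    fun _ => rfl
  have hψT : ∀ u, T (ι u) = ι (weingarten F N x u) := by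
    intro u
    have hu : ι u = ψ u.ofLp := by simp [ψ]
    rw [hu, LinearEquiv.conj_apply_apply, LinearEquiv.symm_apply_apply, shapeOperator,
      h.shapeMatrix_eq hV hx]
    simp only [ψ, LinearEquiv.trans_apply, WithLp.linearEquiv_symm_apply]
    exact congrArg ι (toLin'_stdMatrix _ _)
  have hT : T.IsSymmetric := by
    intro a c
    obtain ⟨u, rfl⟩ := ι.surjective a
    obtain ⟨v, rfl⟩ := ι.surjective c
    rw [hψT, hψT, Submodule.coe_inner, Submodule.coe_inner, hι, hι, hι, hι]
    exact h.inner_weingarten_comm hV hx u v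
  have hn : Module.finrank ℝ (LinearMap.range (fderiv ℝ F x).toLinearMap) = n := by
    rw [← ι.finrank_eq]; simp
  refine ⟨(hT.eigenvectorBasis hn).toBasis.map ι.symm, hT.eigenvalues hn, ⟨fun i => ?_,
    fun i j => ?_⟩, hT.eigenvalues_antitone hn, fun μ => ?_⟩
  · apply ι.injective
    rw [← hψT, map_smul]
    simp [hT.apply_eigenvectorBasis hn]
  · rw [← hι, ← hι, ← Submodule.coe_inner]
    simp [orthonormal_iff_ite.1 (hT.eigenvectorBasis hn).orthonormal]
  · have := hT.card_filter_eigenvalues_eq hn μ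
    rw [finrank_eigenspace_conj] at this
    exact this

end PrincipalBasis

/-! ### Linear algebra of the spectrum and of the trace identities. -/

section Algebra

/-- A traceless spectrum `d₀ ≥ d₁ ≥ d₂ ≥ d₃` with vanishing product whose least value is exactly
double. -/
lemma eq_of_least_double {d : Fin 4 → ℝ} (hd : Antitone d) (hsum : ∑ i, d i = 0)
    (hprod : ∏ i, d i = 0) (h2 : Finset.card {i | d i = d 3} = 2) :
    d = ![-2 * d 3, 0, d 3, d 3] := by
  have h01 : d 1 ≤ d 0 := hd (by decide)
  have h12 : d 2 ≤ d 1 := hd (by decide)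
  have h23 : d 3 ≤ d 2 := hd (by decide)
  rw [Fin.sum_univ_four] at hsum
  rw [Fin.prod_univ_four] at hprod
  have hcard : (if d 0 = d 3 then 1 else 0) + (if d 1 = d 3 then 1 else 0) +
      (if d 2 = d 3 then 1 else 0) + 1 = 2 := by
    rw [← h2, Finset.card_filter, Fin.sum_univ_four]; simp
  have e2 : d 2 = d 3 := by
    by_contra hne
    have h1 : d 1 ≠ d 3 := fun h => hne (by linarith)
    have h0 : d 0 ≠ d 3 := fun h => hne (by linarith)
    simp [hne, h1, h0] at hcard
  have e1 : d 1 ≠ d 3 := fun h => by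
    simp only [e2, h, if_true] at hcard
    omega
  -- Strictness and zero sum give $d_3<0<d_0$, so the vanishing factor of the product can only be
  -- $d_1$.
  have h13 : d 3 < d 1 := lt_of_le_of_ne (by linarith) (Ne.symm e1)
  have h3 : d 3 < 0 := by linarith
  have h0 : 0 < d 0 := by linarith
  have hz1 : d 1 = 0 := by
    rcases mul_eq_zero.1 hprod with h | h
    · rcases mul_eq_zero.1 h with h | h
      · rcases mul_eq_zero.1 h with h | h
        · linarith
        · exact h
      · linarith
    · linarith
  ext i
  fin_cases i
  · simp; linarith
  · simpa using hz1
  · simpa using e2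
  · simp

/-- The algebraic identities satisfied by the splitting tensor at a point with principal
curvatures `-2a, 0, a, a` force `a = 0`. -/
lemma eq_zero_of_splitting_identities {a : ℝ} {d : Fin 4 → ℝ} (hd : d = ![-2 * a, 0, a, a])
    {C : Matrix (Fin 4) (Fin 4) ℝ} (hsymm : (Matrix.diagonal d * C).IsSymm)
    (h1 : (C * Matrix.diagonal d).trace = 0)
    (h2 : (C * Matrix.diagonal d * Matrix.diagonal d).trace = 0)
    (h3 : (C * C * Matrix.diagonal d).trace = 0)
    (h4 : 2 * (C * C * Matrix.diagonal d * Matrix.diagonal d).trace +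
      (C * Matrix.diagonal d * C * Matrix.diagonal d).trace +
      (Matrix.diagonal d * Matrix.diagonal d).trace = 0) : a = 0 := by
  by_contra ha
  have hs : ∀ i j, d i * C i j = d j * C j i := fun i j => by
    have := congrFun (congrFun hsymm j) i
    simpa [Matrix.diagonal_mul] using this
  have d0 : d 0 = -2 * a := by rw [hd]; rfl
  have d1 : d 1 = 0 := by rw [hd]; rfl
  have d2 : d 2 = a := by rw [hd]; rfl
  have d3 : d 3 = a := by rw [hd]; rfl
  have hmul : ∀ (B : Matrix (Fin 4) (Fin 4) ℝ) i k, (B * C) i k = ∑ j, B i j * C j k :=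
    fun _ _ _ => Matrix.mul_apply
  simp only [Matrix.trace, Matrix.diag_apply, hmul, Matrix.mul_diagonal,
    Matrix.diagonal_apply_eq, Fin.sum_univ_four, d0, d1, d2, d3] at h1 h2 h3 h4
  -- Since $d_1=0$, symmetry of $AC$ kills the off-diagonal entries of column 1. The entries of row
  -- 1 then drop out of all four traces.
  have c01 : C 0 1 = 0 := by
    have := hs 0 1; rw [d0, d1] at this
    have h : a * C 0 1 = 0 := by linarith
    exact (mul_eq_zero.1 h).resolve_left ha
  have c21 : C 2 1 = 0 := by
    have := hs 2 1; rw [d2, d1, zero_mul] at this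
    exact (mul_eq_zero.1 this).resolve_left ha
  have c31 : C 3 1 = 0 := by
    have := hs 3 1; rw [d3, d1, zero_mul] at this
    exact (mul_eq_zero.1 this).resolve_left ha
  have c20 : C 2 0 = -2 * C 0 2 := by
    have := hs 2 0; rw [d2, d0] at this
    exact mul_left_cancel₀ ha (by linarith)
  have c30 : C 3 0 = -2 * C 0 3 := by
    have := hs 3 0; rw [d3, d0] at this
    exact mul_left_cancel₀ ha (by linarith)
  have c32 : C 3 2 = C 2 3 := by
    have := hs 3 2; rw [d3, d2] at this
    exact mul_left_cancel₀ ha this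
  have k1 : -2 * C 0 0 + C 2 2 + C 3 3 = 0 := by
    refine (mul_eq_zero.1 (?_ : a * (-2 * C 0 0 + C 2 2 + C 3 3) = 0)).resolve_left ha
    linarith
  have k2 : 4 * C 0 0 + C 2 2 + C 3 3 = 0 := by
    refine (mul_eq_zero.1 (?_ : a ^ 2 * (4 * C 0 0 + C 2 2 + C 3 3) = 0)).resolve_left
      (pow_ne_zero 2 ha)
    linarith
  have c00 : C 0 0 = 0 := by linarith
  have c33 : C 3 3 = -C 2 2 := by linarith
  rw [c01, c21, c31, c20, c30, c32, c00, c33] at h3 h4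
  -- In $\operatorname{tr}C^2A$ the product $C_{02}C_{20}=-2C_{02}^2$ has total weight $-2a+a=-a$,
  -- so it contributes $+2aC_{02}^2$, and likewise for $C_{03}$. All the squares thus carry the same
  -- coefficient $2a$.
  have k3 : C 0 2 ^ 2 + C 0 3 ^ 2 + C 2 2 ^ 2 + C 2 3 ^ 2 = 0 := by
    refine (mul_eq_zero.1 (?_ : (2 * a) * (C 0 2 ^ 2 + C 0 3 ^ 2 + C 2 2 ^ 2 + C 2 3 ^ 2) = 0)
      ).resolve_left (by simpa using ha)
    linarith
  have c02 : C 0 2 = 0 := by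
    refine pow_eq_zero_iff two_ne_zero |>.1 ?_
    linarith [sq_nonneg (C 0 2), sq_nonneg (C 0 3), sq_nonneg (C 2 2), sq_nonneg (C 2 3)]
  have c03 : C 0 3 = 0 := by
    refine pow_eq_zero_iff two_ne_zero |>.1 ?_
    linarith [sq_nonneg (C 0 2), sq_nonneg (C 0 3), sq_nonneg (C 2 2), sq_nonneg (C 2 3)]
  have c22 : C 2 2 = 0 := by
    refine pow_eq_zero_iff two_ne_zero |>.1 ?_
    linarith [sq_nonneg (C 0 2), sq_nonneg (C 0 3), sq_nonneg (C 2 2), sq_nonneg (C 2 3)]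
  have c23 : C 2 3 = 0 := by
    refine pow_eq_zero_iff two_ne_zero |>.1 ?_
    linarith [sq_nonneg (C 0 2), sq_nonneg (C 0 3), sq_nonneg (C 2 2), sq_nonneg (C 2 3)]
  rw [c02, c03, c22, c23] at h4
  -- Only $\operatorname{tr}A^2=6a^2$ survives in the fourth identity.
  have : a ^ 2 = 0 := by linarith
  exact ha (pow_eq_zero_iff two_ne_zero |>.1 this)

end Algebra

/-! ### Points where an extreme principal curvature is double. -/

section DoubleExtreme

lemma mem_principalCurvatures_iff {n : ℕ} {V : Type*} [NormedAddCommGroup V] [InnerProductSpace ℝ V]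
    {F : EuclideanSpace ℝ (Fin n) → V}
    {x : EuclideanSpace ℝ (Fin n)} {ν : V} {d : Fin n → ℝ}
    (hd : ∀ μ, Finset.card {i | d i = μ} = principalMultiplicity F x ν μ) (μ : ℝ) :
    μ ∈ principalCurvatures F x ν ↔ ∃ i, d i = μ := by
  rw [principalCurvatures, Set.mem_ofPred_eq, Module.End.hasEigenvalue_iff, ne_eq,
    ← Submodule.finrank_eq_zero (R := ℝ), ← principalMultiplicity, ← hd, Finset.card_eq_zero,
    Finset.filter_eq_empty_iff]
  simp

variable {V : Type*} [NormedAddCommGroup V] [InnerProductSpace ℝ V] [CompleteSpace V]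
  [FiniteDimensional ℝ V] {F N : EuclideanSpace ℝ (Fin 4) → V}
  {U : Set (EuclideanSpace ℝ (Fin 4))} {x : EuclideanSpace ℝ (Fin 4)}

lemma exists_ne_zero_of_det_stdMatrix_eq_zero {n : ℕ}
    {A : EuclideanSpace ℝ (Fin n) →L[ℝ] EuclideanSpace ℝ (Fin n)} (hA : (stdMatrix A).det = 0) :
    ∃ u, u ≠ 0 ∧ A u = 0 := by
  obtain ⟨v, hv, hAv⟩ := Matrix.exists_mulVec_eq_zero_iff.2 hA
  refine ⟨WithLp.toLp 2 v, fun h0 => hv (congrArg WithLp.ofLp h0), ?_⟩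
  rw [← toLin'_stdMatrix, Matrix.toLin'_apply, hAv]
  rfl

/-- A minimal hypersurface with `|A|²` constant and vanishing Gauss–Kronecker curvature has
`|A|² = 0` if it has a point with principal curvatures `-2a, 0, a, a`. -/
theorem IsHypersurfacePatch.trace_sq_eq_zero (h : IsHypersurfacePatch F N U)
    (hV : Module.finrank ℝ V = 4 + 2) (hx : x ∈ U)
    (htr : ∀ y ∈ U, traceCLM 4 (weingarten F N y) = 0) {c : ℝ}
    (hsq : ∀ y ∈ U, traceCLM 4 (weingarten F N y * weingarten F N y) = c)
    (hdet : ∀ y ∈ U, (stdMatrix (weingarten F N y)).det = 0)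
    {b : Module.Basis (Fin 4) ℝ (EuclideanSpace ℝ (Fin 4))} {a : ℝ}
    (hb : IsPrincipalBasis F N x b ![-2 * a, 0, a, a]) : c = 0 := by
  suffices ha : a = 0 by
    rw [← hsq x hx, hb.traceCLM_weingarten_sq, Fin.sum_univ_four, ha]
    simp
  by_contra ha
  set d : Fin 4 → ℝ := ![-2 * a, 0, a, a] with hd
  have hd0 : ∀ i, i ≠ 1 → d i ≠ 0 := by
    intro i hi
    fin_cases i <;> simp_all
  have hAw : weingarten F N x (b 1) = 0 := by
    rw [hb.weingarten_apply, show d 1 = 0 from rfl, zero_smul]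
  have hker : ∀ u, weingarten F N x u = 0 →
      ⟪fderiv ℝ F x (b 1), fderiv ℝ F x u⟫_ℝ = 0 → u = 0 := fun u hu h1 => by
    apply b.ext_elem
    intro i
    rw [map_zero, Finsupp.zero_apply]
    by_cases hi : i = 1
    · rw [hi, ← hb.inner_eq_repr, h1]
    · have h2 := h.inner_weingarten_comm hV hx (b i) u
      rw [hu, map_zero, inner_zero_right, hb.weingarten_apply, map_smul, inner_smul_left,
        hb.inner_eq_repr] at h2
      exact (mul_eq_zero.1 h2).resolve_left (hd0 i hi)
  obtain ⟨U', hU', hx', X, hX⟩ := h.exists_nullityField hV hx (b.ne_zero 1) hAw hker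
    fun y hy => exists_ne_zero_of_det_stdMatrix_eq_zero (hdet y hy)
  have htr' := fun y hy => htr y (hU' hy)
  have hsq' := fun y hy => hsq y (hU' hy)
  have e1 := hX.trace_splittingTensor_mul hV htr' hx'
  have e2 := hX.trace_splittingTensor_mul_sq hV hsq' hx'
  have e3 := hX.trace_splittingTensor_sq_mul hV htr' hx'
  have e4 := hX.trace_splittingTensor_sq_mul_sq hV hsq' hx'
  simp only [traceCLM_eq_trace_toMatrix b, ContinuousLinearMap.toLinearMap_mul,
    LinearMap.toMatrix_mul, hb.toMatrix_weingarten] at e1 e2 e3 e4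
  refine ha (eq_zero_of_splitting_identities hd ?_ e1 e2 e3 e4)
  rw [← hb.toMatrix_weingarten, ← LinearMap.toMatrix_mul]
  ext i j
  rw [Matrix.transpose_apply, LinearMap.toMatrix_apply, LinearMap.toMatrix_apply,
    ← hb.inner_eq_repr, ← hb.inner_eq_repr, real_inner_comm]
  exact hX.inner_weingarten_splittingTensor_comm hV hx' (b i) (b j)

lemma IsHypersurfacePatch.exists_basis_of_least_double (h : IsHypersurfacePatch F N U)
    (hV : Module.finrank ℝ V = 4 + 2) (hx : x ∈ U)
    (htr : traceCLM 4 (weingarten F N x) = 0) (hdet : (stdMatrix (weingarten F N x)).det = 0)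
    {μ : ℝ} (hμ : IsLeast (principalCurvatures F x (N x)) μ)
    (hm : principalMultiplicity F x (N x) μ = 2) :
    ∃ b a, IsPrincipalBasis F N x b ![-2 * a, 0, a, a] := by
  obtain ⟨b, d, hb, hd, hcard⟩ := h.exists_isPrincipalBasis hV hx
  have h3 : μ = d 3 := by
    obtain ⟨i, hi⟩ := (mem_principalCurvatures_iff hcard μ).1 hμ.1
    refine le_antisymm (hμ.2 ((mem_principalCurvatures_iff hcard _).2 ⟨3, rfl⟩)) ?_
    rw [← hi]
    exact hd (Fin.le_last i)
  rw [h3, ← hcard] at hm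
  have := eq_of_least_double hd (hb.traceCLM_weingarten ▸ htr) (hb.det_weingarten ▸ hdet) hm
  exact ⟨b, d 3, this ▸ hb⟩

lemma IsHypersurfacePatch.exists_basis_of_greatest_double (h : IsHypersurfacePatch F N U)
    (hV : Module.finrank ℝ V = 4 + 2) (hx : x ∈ U)
    (htr : traceCLM 4 (weingarten F N x) = 0) (hdet : (stdMatrix (weingarten F N x)).det = 0)
    {μ : ℝ} (hμ : IsGreatest (principalCurvatures F x (N x)) μ)
    (hm : principalMultiplicity F x (N x) μ = 2) :
    ∃ b a, IsPrincipalBasis F N x b ![-2 * a, 0, a, a] := by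
  obtain ⟨b, d, hb, hd, hcard⟩ := h.exists_isPrincipalBasis hV hx
  have h0 : μ = d 0 := by
    obtain ⟨i, hi⟩ := (mem_principalCurvatures_iff hcard μ).1 hμ.1
    refine le_antisymm ?_ (hμ.2 ((mem_principalCurvatures_iff hcard _).2 ⟨0, rfl⟩))
    rw [← hi]
    exact hd (Fin.zero_le i)
  rw [h0, ← hcard] at hm
  rw [hb.traceCLM_weingarten] at htr
  rw [hb.det_weingarten] at hdet
  -- Negating and reversing the spectrum turns a double greatest value into a double least one,
  -- while keeping the order, the zero sum and the zero product.
  have hrev : (fun i => -d (Fin.rev i)) = ![-2 * -d 0, 0, -d 0, -d 0] := by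
    refine eq_of_least_double (d := fun i => -d (Fin.rev i))
      (fun i j hij => neg_le_neg (hd (Fin.rev_le_rev.2 hij))) ?_ ?_ ?_
    · rw [Finset.sum_neg_distrib, neg_eq_zero, ← htr]
      exact Equiv.sum_comp Fin.revPerm d
    · rw [Fin.prod_univ_four] at hdet ⊢
      change -d 3 * -d 2 * -d 1 * -d 0 = 0
      linarith
    · rw [← hm]
      refine Finset.card_equiv Fin.revPerm fun i => ?_
      simp only [Finset.mem_filter, Finset.mem_univ, true_and, Fin.revPerm_apply]
      exact neg_inj
  refine ⟨b.reindex Fin.revPerm.symm, d 0, ?_⟩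
  have hd' : d ∘ Fin.revPerm = ![-2 * d 0, 0, d 0, d 0] := by
    ext i
    have := congrFun hrev i
    rw [Function.comp_apply, Fin.revPerm_apply, ← neg_neg (d (Fin.rev i)), this]
    fin_cases i <;> simp
  exact hd' ▸ hb.reindex Fin.revPerm

end DoubleExtreme

/-! ### Local extension of a unit normal. -/

section UnitNormal

variable {n : ℕ} {V : Type*} [NormedAddCommGroup V] [InnerProductSpace ℝ V]
  {F : EuclideanSpace ℝ (Fin n) → V} {W : Set (EuclideanSpace ℝ (Fin n))}
  {x : EuclideanSpace ℝ (Fin n)}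

lemma IsHypersurfacePatch.isUnitNormal {N : EuclideanSpace ℝ (Fin n) → V}
    (h : IsHypersurfacePatch F N W) (hx : x ∈ W) : IsUnitNormal F x (N x) := by
  refine ⟨?_, h.inner_param_normal x hx, fun i => h.inner_fderiv_normal x hx _⟩
  have := h.inner_normal_self x hx
  rw [real_inner_self_eq_norm_sq] at this
  nlinarith [norm_nonneg (N x)]

/-- A unit normal at a point extends to a smooth field of unit normals near that point. -/
lemma exists_isHypersurfacePatch [CompleteSpace V] (hW : IsOpen W) (hF : ∀ y ∈ W, ContDiffAt ℝ ∞ F y)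
    (hinj : ∀ y ∈ W, Function.Injective (fderiv ℝ F y)) (hunit : ∀ y ∈ W, ⟪F y, F y⟫_ℝ = 1)
    (hx : x ∈ W) {ν : V} (hν : IsUnitNormal F x ν) :
    ∃ U ⊆ W, x ∈ U ∧ ∃ N, IsHypersurfacePatch F N U ∧ N x = ν := by
  obtain ⟨hν1, hνF, hνd⟩ := hν
  have hFd : ∀ y ∈ W, ∀ v, ⟪fderiv ℝ F y v, F y⟫_ℝ = 0 := fun y hy v => by
    have hd : DifferentiableAt ℝ F y := (hF y hy).differentiableAt (by simp)
    have := inner_fderiv_add_eq_zero hW hunit hy hd hd v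
    rw [real_inner_comm] at this
    linarith
  have hdF : ∀ y ∈ W, ContDiffAt ℝ ∞ (fderiv ℝ F) y := fun y hy => (hF y hy).fderiv_right (by simp)
  -- The fixed vector $\nu$ is projected off $F(y)$ and the tangent space at $y$. The result equals
  -- $\nu$ at $x$, so it can be normalized nearby.
  set m : EuclideanSpace ℝ (Fin n) → V := fun y =>
    ν - ⟪ν, F y⟫_ℝ • F y - fderiv ℝ F y (tangentCoord (fderiv ℝ F y) ν) with hm
  have hmd : ∀ y ∈ W, ContDiffAt ℝ ∞ m y := fun y hy =>
    (contDiffAt_const.sub ((contDiffAt_const.inner ℝ (hF y hy)).smul (hF y hy))).sub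
      ((hdF y hy).clm_apply
        (((contDiffAt_tangentCoord (hinj y hy)).comp y (hdF y hy)).clm_apply contDiffAt_const))
  have hmF : ∀ y ∈ W, ⟪F y, m y⟫_ℝ = 0 := fun y hy => by
    simp only [hm, inner_sub_right, inner_smul_right, hunit y hy, real_inner_comm (fderiv ℝ F y _),
      hFd y hy, real_inner_comm (F y) ν]
    ring
  have hmdF : ∀ y ∈ W, ∀ v, ⟪fderiv ℝ F y v, m y⟫_ℝ = 0 := fun y hy v => by
    simp only [hm, inner_sub_right, inner_smul_right, hFd y hy,
      inner_apply_tangentCoord (hinj y hy)]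
    ring
  have hmx : m x = ν := by
    have h0 : tangentCoord (fderiv ℝ F x) ν = 0 := by
      apply tangentCoord_eq_zero
      intro v
      rw [← sum_smul_single v, map_sum, sum_inner]
      refine Finset.sum_eq_zero fun i _ => ?_
      rw [map_smul, inner_smul_left]
      exact mul_eq_zero_of_right _ (hνd i)
    simp only [hm, h0, map_zero, sub_zero, real_inner_comm (F x) ν, hνF, zero_smul]
  have hUo : IsOpen (W ∩ m ⁻¹' {0}ᶜ) := ContinuousOn.isOpen_inter_preimage
    (fun y hy => (hmd y hy).continuousAt.continuousWithinAt) hW isOpen_compl_singleton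
  have hν0 : ν ≠ 0 := fun h0 => by simp [h0] at hν1
  refine ⟨W ∩ m ⁻¹' {0}ᶜ, Set.inter_subset_left, ⟨hx, by simpa [hmx] using hν0⟩,
    fun y => ‖m y‖⁻¹ • m y, ?_, by simp [hmx, hν1]⟩
  exact
    { isOpen := hUo
      contDiffAt_param := fun y hy => hF y hy.1
      contDiffAt_normal := fun y hy => (((hmd y hy.1).norm ℝ hy.2).inv
        (norm_ne_zero_iff.2 hy.2)).smul (hmd y hy.1)
      injective_fderiv := fun y hy => hinj y hy.1
      inner_param_self := fun y hy => hunit y hy.1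
      inner_normal_self := fun y hy => by
        have : ‖m y‖ ≠ 0 := norm_ne_zero_iff.2 hy.2
        rw [inner_smul_left, inner_smul_right, real_inner_self_eq_norm_sq]
        simp only [conj_trivial]
        field_simp
      inner_param_normal := fun y hy => by rw [inner_smul_right, hmF y hy.1, mul_zero]
      inner_fderiv_normal := fun y hy v => by rw [inner_smul_right, hmdF y hy.1, mul_zero] }

end UnitNormal

/-! ### From immersions of $M$ to local patches. -/

section Immersion

lemma finrank_ambient : Module.finrank ℝ (EuclideanSpace ℝ (Fin 6)) = 4 + 2 := by simp

lemma inner_localParam_self {M : Type*} [TopologicalSpace M] (φ : M → S5)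
    (e : OpenPartialHomeomorph M (EuclideanSpace ℝ (Fin 4))) (x : EuclideanSpace ℝ (Fin 4)) :
    ⟪localParam φ e x, localParam φ e x⟫_ℝ = 1 := by
  rw [real_inner_self_eq_norm_sq, localParam, norm_eq_of_mem_sphere, one_pow]

variable {M : Type*} [TopologicalSpace M] [ChartedSpace (EuclideanSpace ℝ (Fin 4)) M]
  {φ : M → S5} {e : OpenPartialHomeomorph M (EuclideanSpace ℝ (Fin 4))}
  {x : EuclideanSpace ℝ (Fin 4)} {U : Set (EuclideanSpace ℝ (Fin 4))}
  {N : EuclideanSpace ℝ (Fin 4) → EuclideanSpace ℝ (Fin 6)}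

lemma IsMinimal.traceCLM_weingarten (hmin : IsMinimal φ)
    (he : e ∈ atlas (EuclideanSpace ℝ (Fin 4)) M) (h : IsHypersurfacePatch (localParam φ e) N U)
    (hU : U ⊆ e.target) (hx : x ∈ U) : traceCLM 4 (weingarten (localParam φ e) N x) = 0 := by
  have := hmin e he x (hU hx) (N x) (h.isUnitNormal hx)
  rw [meanCurvature, h.shapeMatrix_eq finrank_ambient hx] at this
  rw [traceCLM_apply]
  exact (mul_eq_zero.1 this).resolve_left (by norm_num)

lemma HasZeroGaussKronecker.det_weingarten (hGK : HasZeroGaussKronecker φ)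
    (he : e ∈ atlas (EuclideanSpace ℝ (Fin 4)) M) (h : IsHypersurfacePatch (localParam φ e) N U)
    (hU : U ⊆ e.target) (hx : x ∈ U) : (stdMatrix (weingarten (localParam φ e) N x)).det = 0 := by
  rw [← h.shapeMatrix_eq finrank_ambient hx]
  exact hGK e he x (hU hx) (N x) (h.isUnitNormal hx)

/-- The Gauss equation with zero trace; $12=4\cdot3$ is the scalar curvature of the unit
four-sphere. -/
lemma IsMinimal.traceCLM_weingarten_sq (hmin : IsMinimal φ)
    (he : e ∈ atlas (EuclideanSpace ℝ (Fin 4)) M) (h : IsHypersurfacePatch (localParam φ e) N U)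
    (hU : U ⊆ e.target) (hx : x ∈ U) :
    traceCLM 4 (weingarten (localParam φ e) N x * weingarten (localParam φ e) N x) =
      12 - scalarCurvature (localParam φ e) x := by
  have h0 := hmin.traceCLM_weingarten he h hU hx
  rw [traceCLM_apply] at h0
  rw [h.scalarCurvature_eq finrank_ambient hx, h0, traceCLM_apply, stdMatrix_mul]
  norm_num

variable [IsManifold (𝓡 4) ∞ M]

lemma IsSmoothImmersion.contDiffAt_localParam (hφ : IsSmoothImmersion φ)
    (he : e ∈ atlas (EuclideanSpace ℝ (Fin 4)) M) (hx : x ∈ e.target) :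
    ContDiffAt ℝ ∞ (localParam φ e) x := by
  have : Fact (Module.finrank ℝ (EuclideanSpace ℝ (Fin 6)) = 5 + 1) := ⟨by simp⟩
  have h1 : ContMDiffAt (𝓡 4) (𝓡 4) ∞ e.symm x :=
    (contMDiffOn_symm_of_mem_maximalAtlas
      (IsManifold.subset_maximalAtlas he)).contMDiffAt (e.open_target.mem_nhds hx)
  have h2 : ContMDiffAt (𝓡 4) (𝓡 5) ∞ (φ ∘ e.symm) x := (hφ.1 _).comp x h1
  have h3 : ContMDiffAt (𝓡 4) 𝓘(ℝ, EuclideanSpace ℝ (Fin 6)) ∞ (localParam φ e) x :=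
    (contMDiff_coe_sphere (E := EuclideanSpace ℝ (Fin 6)) (n := 5) (φ (e.symm x))).comp x h2
  exact h3.contDiffAt

lemma IsSmoothImmersion.injective_fderiv_localParam (hφ : IsSmoothImmersion φ)
    (he : e ∈ atlas (EuclideanSpace ℝ (Fin 4)) M) (hx : x ∈ e.target) :
    Function.Injective (fderiv ℝ (localParam φ e) x) := by
  have : Fact (Module.finrank ℝ (EuclideanSpace ℝ (Fin 6)) = 5 + 1) := ⟨by simp⟩
  have hed : e.MDifferentiable (𝓡 4) (𝓡 4) := mdifferentiable_of_mem_atlas he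
  have h1 : MDifferentiableAt (𝓡 4) (𝓡 4) e.symm x := hed.mdifferentiableAt_symm hx
  have h2 : MDifferentiableAt (𝓡 4) (𝓡 5) φ (e.symm x) := (hφ.1 _).mdifferentiableAt (by simp)
  have h3 : MDifferentiableAt (𝓡 5) 𝓘(ℝ, EuclideanSpace ℝ (Fin 6))
      ((↑) : S5 → EuclideanSpace ℝ (Fin 6)) (φ (e.symm x)) :=
    (contMDiff_coe_sphere (E := EuclideanSpace ℝ (Fin 6)) (n := 5) (m := ∞)
      (φ (e.symm x))).mdifferentiableAt (by simp)
  have hsymm : Function.Injective (mfderiv (𝓡 4) (𝓡 4) e.symm x) := fun u v huv => by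
    have hl : ∀ w, mfderiv (𝓡 4) (𝓡 4) e (e.symm x) (mfderiv (𝓡 4) (𝓡 4) e.symm x w) = w :=
      fun w => DFunLike.congr_fun (hed.comp_symm_deriv hx) w
    have := congrArg (mfderiv (𝓡 4) (𝓡 4) e (e.symm x)) huv
    rwa [hl, hl] at this
  have hφe : Function.Injective (mfderiv (𝓡 4) (𝓡 5) (φ ∘ e.symm) x) := by
    rw [mfderiv_comp x h2 h1]
    exact (hφ.2 _).comp hsymm
  have hparam : Function.Injective
      (mfderiv (𝓡 4) 𝓘(ℝ, EuclideanSpace ℝ (Fin 6)) (Subtype.val ∘ (φ ∘ e.symm)) x) := by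
    rw [mfderiv_comp x (f := φ ∘ e.symm) h3 (h2.comp x h1)]
    exact (injective_mvfderiv_subtypeVal_sphere (n := 5) (φ (e.symm x))).comp hφe
  rw [mfderiv_eq_fderiv] at hparam
  exact hparam

lemma IsSmoothImmersion.exists_patch (hφ : IsSmoothImmersion φ)
    (he : e ∈ atlas (EuclideanSpace ℝ (Fin 4)) M) (hx : x ∈ e.target)
    {ν : EuclideanSpace ℝ (Fin 6)} (hν : IsUnitNormal (localParam φ e) x ν) :
    ∃ U ⊆ e.target, x ∈ U ∧ ∃ N, IsHypersurfacePatch (localParam φ e) N U ∧ N x = ν :=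
  exists_isHypersurfacePatch e.open_target (fun _ hy => hφ.contDiffAt_localParam he hy)
    (fun _ hy => hφ.injective_fderiv_localParam he hy) (fun y _ => inner_localParam_self φ e y)
    hx hν

/-- A minimal immersion with the scalar curvature of the unit four-sphere is totally geodesic. -/
lemma IsMinimal.isTotallyGeodesic (hφ : IsSmoothImmersion φ) (hmin : IsMinimal φ)
    (hscal : ∀ e ∈ atlas (EuclideanSpace ℝ (Fin 4)) M, ∀ x ∈ e.target,
      scalarCurvature (localParam φ e) x = 12) : IsTotallyGeodesic φ := by
  intro e he x hx ν hν
  obtain ⟨U, hU, hxU, N, h, rfl⟩ := hφ.exists_patch he hx hν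
  have hsq := hmin.traceCLM_weingarten_sq he h hU hxU
  rw [hscal e he x hx, sub_self] at hsq
  obtain ⟨b, d, hb, -, -⟩ := h.exists_isPrincipalBasis finrank_ambient hxU
  rw [hb.traceCLM_weingarten_sq, Finset.sum_eq_zero_iff_of_nonneg fun i _ => sq_nonneg _] at hsq
  have hA : weingarten (localParam φ e) N x = 0 := by
    apply ContinuousLinearMap.coe_injective
    refine b.ext fun i => ?_
    have hi : d i = 0 := pow_eq_zero_iff two_ne_zero |>.1 (hsq i (Finset.mem_univ i))
    simp [hb.weingarten_apply, hi]
  ext i j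
  rw [h.secondFundamentalForm_apply finrank_ambient hxU, hA]
  simp

end Immersion

end SphereHypersurface

end

/-! ### The main theorem. -/

theorem lemma3p4 {M : Type*} [TopologicalSpace M] [T2Space M] [CompactSpace M]
    [ChartedSpace (EuclideanSpace ℝ (Fin 4)) M] [IsManifold (𝓡 4) ∞ M]
    (φ : M → SphereHypersurface.S5)
    (hφ : SphereHypersurface.IsSmoothImmersion φ)
    (hmin : SphereHypersurface.IsMinimal φ)
    (hscal : SphereHypersurface.HasConstantScalarCurvature φ)
    (hGK : SphereHypersurface.HasZeroGaussKronecker φ)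
    (p : M)
    (hp : SphereHypersurface.SmallestHasMultiplicity φ p 2 ∨
      SphereHypersurface.LargestHasMultiplicity φ p 2) :
    SphereHypersurface.IsTotallyGeodesic φ := by
  open SphereHypersurface in
  obtain ⟨c, hc⟩ := hscal
  -- On a patch around such a point $\operatorname{tr}A^2$ is the constant $12-c$, and the local
  -- theorem makes it zero. As $c$ is the same in every chart, this determines the scalar curvature
  -- on all of $M$.
  have key : ∀ e ∈ atlas (EuclideanSpace ℝ (Fin 4)) M, ∀ x ∈ e.target, ∀ ν,
      IsUnitNormal (localParam φ e) x ν → (∃ μ,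
        (IsLeast (principalCurvatures (localParam φ e) x ν) μ ∨
          IsGreatest (principalCurvatures (localParam φ e) x ν) μ) ∧
        principalMultiplicity (localParam φ e) x ν μ = 2) → c = 12 := by
    rintro e he x hx ν hν ⟨μ, hμ, hm⟩
    obtain ⟨U, hU, hxU, N, h, rfl⟩ := hφ.exists_patch he hx hν
    have htr := fun y (hy : y ∈ U) => hmin.traceCLM_weingarten he h hU hy
    have hdet := fun y (hy : y ∈ U) => hGK.det_weingarten he h hU hy
    have hsq : ∀ y ∈ U, traceCLM 4 (weingarten (localParam φ e) N y *
        weingarten (localParam φ e) N y) = 12 - c := fun y hy => by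
      rw [hmin.traceCLM_weingarten_sq he h hU hy, hc e he y (hU hy)]
    obtain ⟨b, a, hb⟩ : ∃ b a, IsPrincipalBasis (localParam φ e) N x b ![-2 * a, 0, a, a] := by
      rcases hμ with hμ | hμ
      · exact h.exists_basis_of_least_double finrank_ambient hxU (htr x hxU) (hdet x hxU) hμ hm
      · exact h.exists_basis_of_greatest_double finrank_ambient hxU (htr x hxU) (hdet x hxU) hμ hm
    linarith [h.trace_sq_eq_zero finrank_ambient hxU htr hsq hdet hb]
  have hc12 : c = 12 := by
    rcases hp with ⟨e, he, hpe, ν, hν, μ, hμ, hm⟩ | ⟨e, he, hpe, ν, hν, μ, hμ, hm⟩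
    · exact key e he _ (e.map_source hpe) ν hν ⟨μ, Or.inl hμ, hm⟩
    · exact key e he _ (e.map_source hpe) ν hν ⟨μ, Or.inr hμ, hm⟩
  exact hmin.isTotallyGeodesic hφ fun e he x hx => (hc e he x hx).trans hc12
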